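/- Let $m,n,p\ge 0$ be integers, let $X$ be a fixed real $m\times p$ matrix of rank $q$, let $A$ be a fixed real $p\times n$ matrix of rank $r$, let $E$ be a random real $m\times n$ matrix, and let $Y=XA+E$. Write $d_1(C)\ge d_2(C)\ge\dots$ for the singular values of a real matrix $C$, in decreasing order (with $d_k(C)=0$ for $k>\operatorname{rank}C$), $\|C\|_F$ for its Frobenius norm and $\|C\|_1=\sum_k d_k(C)$ for its nuclear norm. Let $\tau\in\mathbb R$, and let $\tilde A$ be a minimizer of $$\|Y-XB\|_F^2+2\tau\|B\|_1$$ over all real $p\times n$ matrices $B$ (any choice of a minimizer for each outcome). Let $M=X'X$ and $$\tilde k=\max\{k : 1\le k\le \min(p,n),\ d_k(M\tilde A)>2\tau\},$$ with $\max\emptyset=0$. Assume that $d_r(MA)>4\tau$ (no assumption if $r=0$). Then $$\mathbb P\{\tilde k\ne r\}\le \mathbb P\{d_1(X'E)>\tau\}.$$ If moreover the entries of $E$ are independent $N(0,\sigma^2)$ random variables with $\sigma\ge 0$, and $\tau=(1+\theta)\,\sigma\, d_1(X)(\sqrt n+\sqrt q)$ for some $\theta>0$, then $$\mathbb P\{\tilde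 k\ne r\}\le\exp(-\theta^2(n+q)/2)\quad\text{and}\quad \mathbb P\{d_1(X'E)>\tau\}\le \exp(-\theta^2(n+q)/2).$$ -/

import Mathlib

open MeasureTheory ProbabilityTheory
open scoped Matrix

noncomputable section

namespace ReducedRank

/-- The `k`-th largest singular value `d_k(C)` of a real matrix `C`, for `k = 1, 2, …`, counted
with multiplicity and equal to `0` for `k > rank C`. (Mathlib numbers the singular values from `0`.
The value at `k = 0` has no meaning and is not used.) -/
def d {a b : ℕ} (C : Matrix (Fin a) (Fin b) ℝ) (k : ℕ) : ℝ :=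
  (Matrix.toEuclideanLin C).singularValues (k - 1)

/-- The squared Frobenius norm `‖C‖_F²`, the sum of the squared entries. -/
def frobSq {a b : ℕ} (C : Matrix (Fin a) (Fin b) ℝ) : ℝ :=
  ∑ i, ∑ j, C i j ^ 2

/-- The nuclear norm `‖B‖₁`, the sum of the singular values. -/
def nuclearNorm {a b : ℕ} (B : Matrix (Fin a) (Fin b) ℝ) : ℝ :=
  ∑ k ∈ Finset.Icc 1 (min a b), d B k

/-- The nuclear norm penalized least squares criterion `‖Y - XB‖_F² + 2τ‖B‖₁`. -/
def nnpObjective {m n p : ℕ} (X : Matrix (Fin m) (Fin p) ℝ) (Y : Matrix (Fin m) (Fin n) ℝ)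
    (τ : ℝ) (B : Matrix (Fin p) (Fin n) ℝ) : ℝ :=
  frobSq (Y - X * B) + 2 * τ * nuclearNorm B

/-- `B` minimizes the nuclear norm penalized least squares criterion over all `p × n` matrices. -/
def IsNNPEstimate {m n p : ℕ} (X : Matrix (Fin m) (Fin p) ℝ) (Y : Matrix (Fin m) (Fin n) ℝ)
    (τ : ℝ) (B : Matrix (Fin p) (Fin n) ℝ) : Prop :=
  ∀ B' : Matrix (Fin p) (Fin n) ℝ, nnpObjective X Y τ B ≤ nnpObjective X Y τ B'

/-- The calibrated rank estimate `max {k : d_k(X'X B) > 2τ}` computed from the estimate `B`, where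
`k` runs over the indices `1, …, min(p, n)` of the singular values of the `p × n` matrix `X'X B`;
the maximum of the empty set is `0`. -/
def calibratedRank {m n p : ℕ} (X : Matrix (Fin m) (Fin p) ℝ) (τ : ℝ)
    (B : Matrix (Fin p) (Fin n) ℝ) : ℕ :=
  ((Finset.Icc 1 (min p n)).filter (fun k => 2 * τ < d (Xᵀ * X * B) k)).sup id

/-- The entries of the random matrix `E` are independent with law `N(0, σ²)`. -/
def IsIIDGaussian {Ω : Type*} [MeasurableSpace Ω] (P : Measure Ω) {m n : ℕ}
    (E : Ω → Matrix (Fin m) (Fin n) ℝ) (σ : ℝ) : Prop :=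
  iIndepFun (fun (ij : Fin m × Fin n) (ω : Ω) => E ω ij.1 ij.2) P ∧
    ∀ i j, HasLaw (fun ω => E ω i j) (gaussianReal 0 (σ ^ 2).toNNReal) P

end ReducedRank

end

namespace LinearMap

open Module InnerProductSpace
open scoped RealInnerProductSpace

variable {E F : Type*} [NormedAddCommGroup E] [InnerProductSpace ℝ E] [FiniteDimensional ℝ E]
  [NormedAddCommGroup F] [InnerProductSpace ℝ F] [FiniteDimensional ℝ F]

/-- The orthonormal basis of right singular vectors of `T`. -/
noncomputable def rightSingularBasis (T : E →ₗ[ℝ] F) :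
    OrthonormalBasis (Fin (finrank ℝ E)) ℝ E :=
  T.isSymmetric_adjoint_comp_self.eigenvectorBasis rfl

theorem inner_map_rightSingularBasis (T : E →ₗ[ℝ] F) (i : Fin (finrank ℝ E)) (x : E) :
    ⟪T (T.rightSingularBasis i), T x⟫
      = T.singularValues i ^ 2 * ⟪T.rightSingularBasis i, x⟫ := by
  have h := T.isSymmetric_adjoint_comp_self.apply_eigenvectorBasis rfl i
  rw [← LinearMap.adjoint_inner_left]
  rw [LinearMap.comp_apply] at h
  rw [rightSingularBasis, h, T.sq_singularValues_fin rfl i, inner_smul_left]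
  simp

theorem norm_map_sq_eq_sum_singularValues (T : E →ₗ[ℝ] F) (x : E) :
    ‖T x‖ ^ 2
      = ∑ i : Fin (finrank ℝ E), T.singularValues i ^ 2 * ⟪T.rightSingularBasis i, x⟫ ^ 2 := by
  rw [← real_inner_self_eq_norm_sq]
  conv_lhs => enter [2]; rw [← T.rightSingularBasis.sum_repr' x]
  rw [map_sum, sum_inner]
  refine Finset.sum_congr rfl fun i _ => ?_
  rw [map_smul, inner_smul_left, inner_map_rightSingularBasis]
  simp only [conj_trivial]
  ring

/-- Weyl's perturbation inequality for singular values. -/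
theorem singularValues_le_add_of_norm_sub_le (S T : E →ₗ[ℝ] F) {c : ℝ} (hc : 0 ≤ c)
    (h : ∀ x, ‖S x - T x‖ ≤ c * ‖x‖) (k : ℕ) :
    S.singularValues k ≤ T.singularValues k + c := by
  rcases le_or_gt (finrank ℝ E) k with hk | hk
  · rw [S.singularValues_of_finrank_le hk, T.singularValues_of_finrank_le hk]
    simpa using hc
  let U : Submodule ℝ E :=
    Submodule.span ℝ (Set.range fun i : {i : Fin (finrank ℝ E) // (i : ℕ) ≤ k} =>
      S.rightSingularBasis i)
  let W : Submodule ℝ E :=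
    Submodule.span ℝ (Set.range fun i : {i : Fin (finrank ℝ E) // ¬ (i : ℕ) < k} =>
      T.rightSingularBasis i)
  have hU : finrank ℝ U = k + 1 := by
    change finrank ℝ (Submodule.span ℝ (Set.range (S.rightSingularBasis ∘ Subtype.val))) = _
    rw [finrank_span_eq_card (S.rightSingularBasis.orthonormal.linearIndependent.comp _
      Subtype.val_injective), Fintype.card_subtype]
    have : (Finset.univ.filter fun i : Fin (finrank ℝ E) => (i : ℕ) ≤ k)
        = Finset.Iic (⟨k, hk⟩ : Fin (finrank ℝ E)) := by
      ext i; simp [Fin.le_def]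
    rw [this, Fin.card_Iic]
  have hW : finrank ℝ W = finrank ℝ E - k := by
    change finrank ℝ (Submodule.span ℝ (Set.range (T.rightSingularBasis ∘ Subtype.val))) = _
    rw [finrank_span_eq_card (T.rightSingularBasis.orthonormal.linearIndependent.comp _
      Subtype.val_injective), Fintype.card_subtype]
    have : (Finset.univ.filter fun i : Fin (finrank ℝ E) => ¬ (i : ℕ) < k)
        = Finset.Ici (⟨k, hk⟩ : Fin (finrank ℝ E)) := by
      ext i; simp [Fin.le_def]
    rw [this, Fin.card_Ici]
  obtain ⟨x, hx, hx0⟩ : ∃ x ∈ U ⊓ W, x ≠ 0 := by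
    refine Submodule.exists_mem_ne_zero_of_ne_bot fun hbot => ?_
    have h1 := Submodule.finrank_sup_add_finrank_inf_eq U W
    have h2 := (U ⊔ W).finrank_le
    rw [hbot, finrank_bot] at h1
    omega
  have hxU : ∀ i : Fin (finrank ℝ E), k < (i : ℕ) → ⟪S.rightSingularBasis i, x⟫ = 0 := by
    intro i hi
    refine Submodule.span_induction (p := fun y _ => ⟪S.rightSingularBasis i, y⟫ = 0)
      ?_ (by simp) ?_ ?_ hx.1
    · rintro _ ⟨j, rfl⟩
      refine S.rightSingularBasis.orthonormal.inner_eq_zero fun hij => ?_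
      have := j.2
      rw [← hij] at this
      omega
    · intro y z _ _ hy hz
      rw [inner_add_right, hy, hz, add_zero]
    · intro a y _ hy
      rw [inner_smul_right, hy, mul_zero]
  have hxW : ∀ i : Fin (finrank ℝ E), (i : ℕ) < k → ⟪T.rightSingularBasis i, x⟫ = 0 := by
    intro i hi
    refine Submodule.span_induction (p := fun y _ => ⟪T.rightSingularBasis i, y⟫ = 0)
      ?_ (by simp) ?_ ?_ hx.2
    · rintro _ ⟨j, rfl⟩
      refine T.rightSingularBasis.orthonormal.inner_eq_zero fun hij => ?_
      have := j.2
      rw [← hij] at this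
      omega
    · intro y z _ _ hy hz
      rw [inner_add_right, hy, hz, add_zero]
    · intro a y _ hy
      rw [inner_smul_right, hy, mul_zero]
  have hS : S.singularValues k * ‖x‖ ≤ ‖S x‖ := by
    refine (sq_le_sq₀ (mul_nonneg (S.singularValues_nonneg k) (norm_nonneg _)) (norm_nonneg _)).1 ?_
    rw [mul_pow, norm_map_sq_eq_sum_singularValues,
      ← S.rightSingularBasis.sum_sq_inner_right x, Finset.mul_sum]
    refine Finset.sum_le_sum fun i _ => ?_
    rcases le_or_gt (i : ℕ) k with hi | hi
    · gcongr
      · exact S.singularValues_nonneg k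
      · exact S.singularValues_antitone hi
    · simp [hxU i hi]
  have hT : ‖T x‖ ≤ T.singularValues k * ‖x‖ := by
    refine (sq_le_sq₀ (norm_nonneg _)
      (mul_nonneg (T.singularValues_nonneg k) (norm_nonneg _))).1 ?_
    rw [mul_pow, norm_map_sq_eq_sum_singularValues,
      ← T.rightSingularBasis.sum_sq_inner_right x, Finset.mul_sum]
    refine Finset.sum_le_sum fun i _ => ?_
    rcases lt_or_ge (i : ℕ) k with hi | hi
    · simp [hxW i hi]
    · gcongr
      · exact T.singularValues_nonneg i
      · exact T.singularValues_antitone hi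
  have hxpos : 0 < ‖x‖ := norm_pos_iff.2 hx0
  have htri : ‖S x‖ ≤ ‖T x‖ + ‖S x - T x‖ := by
    simpa using norm_add_le (T x) (S x - T x)
  refine le_of_mul_le_mul_right ?_ hxpos
  linarith [h x]

theorem norm_map_le_singularValues_zero (T : E →ₗ[ℝ] F) (x : E) :
    ‖T x‖ ≤ T.singularValues 0 * ‖x‖ := by
  refine (sq_le_sq₀ (norm_nonneg _)
      (mul_nonneg (T.singularValues_nonneg 0) (norm_nonneg _))).1 ?_
  rw [mul_pow, norm_map_sq_eq_sum_singularValues,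
    ← T.rightSingularBasis.sum_sq_inner_right x, Finset.mul_sum]
  refine Finset.sum_le_sum fun i _ => ?_
  gcongr
  · exact T.singularValues_nonneg i
  · exact T.singularValues_antitone (Nat.zero_le _)

theorem exists_norm_map_eq_singularValues_zero (T : E →ₗ[ℝ] F) (h : 0 < T.singularValues 0) :
    ∃ x, ‖x‖ = 1 ∧ ‖T x‖ = T.singularValues 0 := by
  have hE : 0 < finrank ℝ E := by
    by_contra hE
    rw [T.singularValues_of_finrank_le (not_lt.1 hE)] at h
    exact lt_irrefl _ h
  refine ⟨T.rightSingularBasis ⟨0, hE⟩, T.rightSingularBasis.orthonormal.1 _, ?_⟩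
  have := inner_map_rightSingularBasis T ⟨0, hE⟩ (T.rightSingularBasis ⟨0, hE⟩)
  rw [real_inner_self_eq_norm_sq, real_inner_self_eq_norm_sq,
    T.rightSingularBasis.orthonormal.1] at this
  refine (sq_eq_sq₀ (norm_nonneg _) (T.singularValues_nonneg 0)).1 ?_
  simpa using this

/-- The left singular vectors of `T`, set to zero at the zero singular values. -/
noncomputable def leftSingularVector (T : E →ₗ[ℝ] F) (i : Fin (finrank ℝ E)) : F :=
  (T.singularValues i)⁻¹ • T (T.rightSingularBasis i)

theorem map_rightSingularBasis (T : E →ₗ[ℝ] F) (i : Fin (finrank ℝ E)) :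
    T (T.rightSingularBasis i) = T.singularValues i • T.leftSingularVector i := by
  rcases eq_or_ne (T.singularValues i) 0 with h | h
  · have := inner_map_rightSingularBasis T i (T.rightSingularBasis i)
    rw [h] at this
    rw [h, zero_smul]
    simpa using this
  · rw [leftSingularVector, smul_inv_smul₀ h]

theorem sum_sq_inner_leftSingularVector_le (T : E →ₗ[ℝ] F) (y : F) :
    ∑ i, ⟪T.leftSingularVector i, y⟫ ^ 2 ≤ ‖y‖ ^ 2 := by
  have horth : Orthonormal ℝ
      (fun i : {i : Fin (finrank ℝ E) // T.singularValues i ≠ 0} => T.leftSingularVector i) := by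
    rw [orthonormal_iff_ite]
    rintro ⟨i, hi⟩ ⟨j, hj⟩
    simp only [leftSingularVector, inner_smul_left, inner_smul_right,
      inner_map_rightSingularBasis, orthonormal_iff_ite.1 T.rightSingularBasis.orthonormal,
      conj_trivial, Subtype.mk.injEq]
    split_ifs with hij
    · subst hij
      field_simp
    · simp
  have h := horth.sum_inner_products_le (x := y) (s := Finset.univ)
  simp only [Real.norm_eq_abs, sq_abs] at h
  refine le_trans (le_of_eq ?_) h
  rw [← Finset.sum_subtype (Finset.univ.filter fun i : Fin (finrank ℝ E) =>
    T.singularValues i ≠ 0) (by simp) fun i => ⟪T.leftSingularVector i, y⟫ ^ 2, Finset.sum_filter]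
  refine Finset.sum_congr rfl fun i _ => ?_
  split_ifs with hi
  · rfl
  · simp only [ne_eq, not_not] at hi
    simp [leftSingularVector, hi]

theorem inner_leftSingularVector_map (T : E →ₗ[ℝ] F) (i : Fin (finrank ℝ E)) :
    ⟪T.leftSingularVector i, T (T.rightSingularBasis i)⟫ = T.singularValues i := by
  rw [leftSingularVector, inner_smul_left, inner_map_rightSingularBasis,
    real_inner_self_eq_norm_sq, T.rightSingularBasis.orthonormal.1]
  rcases eq_or_ne (T.singularValues i) 0 with h | h
  · simp [h]
  · simp only [conj_trivial]; field_simp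

theorem norm_leftSingularVector_le_one (T : E →ₗ[ℝ] F) (i : Fin (finrank ℝ E)) :
    ‖T.leftSingularVector i‖ ≤ 1 := by
  rcases eq_or_ne (T.singularValues i) 0 with hi | hi
  · simp [leftSingularVector, hi]
  · have h2 := T.inner_map_rightSingularBasis i (T.rightSingularBasis i)
    rw [real_inner_self_eq_norm_sq, real_inner_self_eq_norm_sq,
      T.rightSingularBasis.orthonormal.1, one_pow, mul_one,
      sq_eq_sq₀ (norm_nonneg _) (T.singularValues_nonneg _)] at h2
    rw [leftSingularVector, norm_smul, h2, norm_inv,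
      Real.norm_of_nonneg (T.singularValues_nonneg _),
      inv_mul_cancel₀ hi]

theorem map_eq_sum_singularValues (T : E →ₗ[ℝ] F) (x : E) :
    T x = ∑ k : Fin (finrank ℝ E),
      (T.singularValues k * ⟪T.rightSingularBasis k, x⟫) • T.leftSingularVector k := by
  conv_lhs => rw [← T.rightSingularBasis.sum_repr' x]
  rw [map_sum]
  refine Finset.sum_congr rfl fun i _ => ?_
  rw [map_smul, map_rightSingularBasis, smul_smul, mul_comm]

/-- The nuclear norm grows at most by the nuclear norm of a perturbation of rank one. -/
theorem sum_singularValues_le_add_of_eq_add_inner_smul (S T : E →ₗ[ℝ] F) (u : F) (v : E)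
    (h : ∀ x, S x = T x + ⟪v, x⟫ • u) :
    ∑ i : Fin (finrank ℝ E), S.singularValues i
      ≤ ∑ i : Fin (finrank ℝ E), T.singularValues i + ‖u‖ * ‖v‖ := by
  have bessel : ∀ (y : F) (x : E),
      ∑ i, ⟪S.leftSingularVector i, y⟫ * ⟪S.rightSingularBasis i, x⟫ ≤ ‖y‖ * ‖x‖ := by
    intro y x
    refine (Real.sum_mul_le_sqrt_mul_sqrt _ _ _).trans ?_
    rw [S.rightSingularBasis.sum_sq_inner_right x, Real.sqrt_sq (norm_nonneg x)]
    gcongr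
    exact Real.sqrt_le_iff.2 ⟨norm_nonneg y, S.sum_sq_inner_leftSingularVector_le y⟩
  have h1 : ∀ i : Fin (finrank ℝ E), S.singularValues i
      = ∑ k : Fin (finrank ℝ E), T.singularValues k
        * (⟪S.leftSingularVector i, T.leftSingularVector k⟫
          * ⟪S.rightSingularBasis i, T.rightSingularBasis k⟫)
        + ⟪S.leftSingularVector i, u⟫ * ⟪S.rightSingularBasis i, v⟫ := by
    intro i
    rw [← S.inner_leftSingularVector_map i, h, inner_add_right, T.map_eq_sum_singularValues,
      inner_sum, inner_smul_right]
    congr 1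
    · refine Finset.sum_congr rfl fun k _ => ?_
      rw [inner_smul_right, real_inner_comm (T.rightSingularBasis k)]
      ring
    · rw [real_inner_comm v, mul_comm]
  calc ∑ i : Fin (finrank ℝ E), S.singularValues i
      = ∑ k : Fin (finrank ℝ E), T.singularValues k
        * ∑ i, (⟪S.leftSingularVector i, T.leftSingularVector k⟫
          * ⟪S.rightSingularBasis i, T.rightSingularBasis k⟫)
        + ∑ i, ⟪S.leftSingularVector i, u⟫ * ⟪S.rightSingularBasis i, v⟫ := by
        rw [Finset.sum_congr rfl fun i _ => h1 i, Finset.sum_add_distrib, Finset.sum_comm]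
        simp only [Finset.mul_sum]
    _ ≤ ∑ k : Fin (finrank ℝ E), T.singularValues k * 1 + ‖u‖ * ‖v‖ := by
        gcongr with k
        · exact T.singularValues_nonneg k
        · refine (bessel _ _).trans ?_
          rw [T.rightSingularBasis.orthonormal.1, mul_one]
          exact T.norm_leftSingularVector_le_one k
        · exact bessel u v
    _ = _ := by simp

end LinearMap

namespace ReducedRank

theorem finrank_range_toEuclideanLin {a b : ℕ} (C : Matrix (Fin a) (Fin b) ℝ) :
    Module.finrank ℝ (LinearMap.range (Matrix.toEuclideanLin C)) = C.rank :=
  (C.rank_eq_finrank_range_toLin (EuclideanSpace.basisFun (Fin a) ℝ).toBasis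
    (EuclideanSpace.basisFun (Fin b) ℝ).toBasis).symm

theorem d_nonneg {a b : ℕ} (C : Matrix (Fin a) (Fin b) ℝ) (k : ℕ) : 0 ≤ d C k :=
  LinearMap.singularValues_nonneg _ _

theorem d_eq_zero_of_rank_lt {a b : ℕ} (C : Matrix (Fin a) (Fin b) ℝ) {k : ℕ} (hk : C.rank < k) :
    d C k = 0 := by
  rw [d, LinearMap.singularValues_eq_zero_iff_le_finrank_range, finrank_range_toEuclideanLin]
  omega

theorem nuclearNorm_eq_sum {a b : ℕ} (B : Matrix (Fin a) (Fin b) ℝ) :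
    nuclearNorm B = ∑ i : Fin (Module.finrank ℝ (EuclideanSpace ℝ (Fin b))),
      (Matrix.toEuclideanLin B).singularValues i := by
  have h : nuclearNorm B
      = ∑ k ∈ Finset.range (min a b), (Matrix.toEuclideanLin B).singularValues k := by
    rw [nuclearNorm, Finset.range_eq_Ico, ← Finset.Ico_add_one_right_eq_Icc,
      ← Finset.sum_Ico_add' (fun k => d B k) 0 (min a b) 1]
    rfl
  rw [h, ← Finset.sum_range fun k => (Matrix.toEuclideanLin B).singularValues k,
    finrank_euclideanSpace_fin]
  refine Finset.sum_subset (by simp) fun k _ hk => ?_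
  rw [LinearMap.singularValues_eq_zero_iff_le_finrank_range, finrank_range_toEuclideanLin]
  have := B.rank_le_height
  have := B.rank_le_width
  simp only [Finset.mem_range, not_lt] at hk
  omega

theorem nuclearNorm_add_vecMulVec_le {a b : ℕ} (B : Matrix (Fin a) (Fin b) ℝ)
    (u : EuclideanSpace ℝ (Fin a)) (v : EuclideanSpace ℝ (Fin b)) :
    nuclearNorm (B + Matrix.vecMulVec u v) ≤ nuclearNorm B + ‖u‖ * ‖v‖ := by
  rw [nuclearNorm_eq_sum, nuclearNorm_eq_sum]
  refine LinearMap.sum_singularValues_le_add_of_eq_add_inner_smul _ _ u v fun x => ?_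
  ext i
  simp [Matrix.toEuclideanLin, Matrix.toLpLin_apply, Matrix.vecMulVec_mulVec,
    EuclideanSpace.inner_eq_star_dotProduct, dotProduct_comm]

theorem frobSq_add {a b : ℕ} (C D : Matrix (Fin a) (Fin b) ℝ) :
    frobSq (C + D) = frobSq C + 2 * ∑ i, ∑ j, C i j * D i j + frobSq D := by
  simp only [frobSq, Finset.mul_sum, ← Finset.sum_add_distrib, Matrix.add_apply]
  refine Finset.sum_congr rfl fun i _ => Finset.sum_congr rfl fun j _ => ?_
  ring

theorem frobSq_smul {a b : ℕ} (t : ℝ) (C : Matrix (Fin a) (Fin b) ℝ) :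
    frobSq (t • C) = t ^ 2 * frobSq C := by
  simp only [frobSq, Finset.mul_sum, Matrix.smul_apply, smul_eq_mul, mul_pow]

theorem sum_mul_vecMulVec {a b : ℕ} (C : Matrix (Fin a) (Fin b) ℝ) (w : Fin a → ℝ)
    (v : Fin b → ℝ) : ∑ i, ∑ j, C i j * Matrix.vecMulVec w v i j = w ⬝ᵥ C *ᵥ v := by
  simp only [dotProduct, Matrix.mulVec, Matrix.vecMulVec_apply, Finset.mul_sum]
  refine Finset.sum_congr rfl fun i _ => Finset.sum_congr rfl fun j _ => ?_
  ring

/-- First order condition for the nuclear norm penalized least squares estimate. -/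
theorem IsNNPEstimate.dotProduct_mulVec_le {m n p : ℕ} {X : Matrix (Fin m) (Fin p) ℝ}
    {Y : Matrix (Fin m) (Fin n) ℝ} {τ : ℝ} (hτ : 0 ≤ τ) {B : Matrix (Fin p) (Fin n) ℝ}
    (hB : IsNNPEstimate X Y τ B) (u : EuclideanSpace ℝ (Fin p)) (v : EuclideanSpace ℝ (Fin n)) :
    u ⬝ᵥ (Xᵀ * (Y - X * B)) *ᵥ v ≤ τ * (‖u‖ * ‖v‖) := by
  set g := u ⬝ᵥ (Xᵀ * (Y - X * B)) *ᵥ v with hg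
  set K := frobSq (Matrix.vecMulVec (X *ᵥ u) v) with hK
  have hquad : ∀ t : ℝ, 0 < t → 2 * g ≤ 2 * (τ * (‖u‖ * ‖v‖)) + t * K := by
    intro t ht
    have h1 := hB (B + Matrix.vecMulVec (t • u) v)
    have h2 := nuclearNorm_add_vecMulVec_le B (t • u) v
    rw [norm_smul, Real.norm_of_nonneg ht.le] at h2
    have h3 : Y - X * (B + Matrix.vecMulVec (t • u) v)
        = (Y - X * B) + (-t) • Matrix.vecMulVec (X *ᵥ u) v := by
      rw [Matrix.mul_add, Matrix.mul_vecMulVec, WithLp.ofLp_smul, Matrix.mulVec_smul,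
        Matrix.smul_vecMulVec]
      rw [neg_smul]; abel
    have h4 : ∑ i, ∑ j, (Y - X * B) i j * ((-t) • Matrix.vecMulVec (X *ᵥ u) v) i j = -t * g := by
      rw [hg, ← Matrix.mulVec_mulVec, Matrix.dotProduct_mulVec, Matrix.vecMul_transpose,
        ← sum_mul_vecMulVec]
      simp only [Finset.mul_sum, Matrix.smul_apply, smul_eq_mul]
      refine Finset.sum_congr rfl fun i _ => Finset.sum_congr rfl fun j _ => ?_
      ring
    rw [nnpObjective, nnpObjective, h3, frobSq_add, h4, frobSq_smul, ← hK] at h1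
    have h5 := mul_le_mul_of_nonneg_left h2 (mul_nonneg zero_le_two hτ)
    refine le_of_mul_le_mul_left ?_ ht
    nlinarith
  have hlim : Filter.Tendsto (fun t : ℝ => 2 * (τ * (‖u‖ * ‖v‖)) + t * K)
      (nhdsWithin 0 (Set.Ioi 0)) (nhds (2 * (τ * (‖u‖ * ‖v‖)) + 0 * K)) :=
    Filter.Tendsto.mono_left (Continuous.tendsto (by fun_prop) 0) nhdsWithin_le_nhds
  have := ge_of_tendsto hlim (Filter.eventually_of_mem self_mem_nhdsWithin hquad)
  linarith

theorem norm_toEuclideanLin_le_of_dotProduct_mulVec_le {a b : ℕ} {G : Matrix (Fin a) (Fin b) ℝ}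
    {c : ℝ} (hc : 0 ≤ c)
    (h : ∀ (u : EuclideanSpace ℝ (Fin a)) (v : EuclideanSpace ℝ (Fin b)),
      u ⬝ᵥ G *ᵥ v ≤ c * (‖u‖ * ‖v‖)) (v : EuclideanSpace ℝ (Fin b)) :
    ‖Matrix.toEuclideanLin G v‖ ≤ c * ‖v‖ := by
  have h1 := h (Matrix.toEuclideanLin G v) v
  have h2 : (Matrix.toEuclideanLin G v : EuclideanSpace ℝ (Fin a)) ⬝ᵥ G *ᵥ v
      = ‖Matrix.toEuclideanLin G v‖ ^ 2 := by
    rw [EuclideanSpace.real_norm_sq_eq]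
    simp [dotProduct, Matrix.toEuclideanLin, Matrix.toLpLin_apply, sq]
  rw [h2] at h1
  rcases (norm_nonneg (Matrix.toEuclideanLin G v)).eq_or_lt with h0 | h0
  · rw [← h0]; positivity
  · refine le_of_mul_le_mul_left ?_ h0
    nlinarith

theorem abs_d_sub_d_le {m n p : ℕ} {X : Matrix (Fin m) (Fin p) ℝ}
    {A : Matrix (Fin p) (Fin n) ℝ} {E : Matrix (Fin m) (Fin n) ℝ} {τ : ℝ}
    {B : Matrix (Fin p) (Fin n) ℝ} (hB : IsNNPEstimate X (X * A + E) τ B)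
    (hE : d (Xᵀ * E) 1 ≤ τ) (k : ℕ) :
    d (Xᵀ * X * A) k ≤ d (Xᵀ * X * B) k + 2 * τ ∧
      d (Xᵀ * X * B) k ≤ d (Xᵀ * X * A) k + 2 * τ := by
  have hτ : 0 ≤ τ := (d_nonneg _ _).trans hE
  have hdiff : ∀ v, ‖Matrix.toEuclideanLin (Xᵀ * X * A) v - Matrix.toEuclideanLin (Xᵀ * X * B) v‖
      ≤ 2 * τ * ‖v‖ := by
    intro v
    have h1 := norm_toEuclideanLin_le_of_dotProduct_mulVec_le hτ
      (fun u v => hB.dotProduct_mulVec_le hτ u v) v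
    have h2 := (Matrix.toEuclideanLin (Xᵀ * E)).norm_map_le_singularValues_zero v
    have h3 : Matrix.toEuclideanLin (Xᵀ * X * A) v - Matrix.toEuclideanLin (Xᵀ * X * B) v
        = Matrix.toEuclideanLin (Xᵀ * (X * A + E - X * B)) v
          - Matrix.toEuclideanLin (Xᵀ * E) v := by
      rw [← LinearMap.sub_apply, ← LinearMap.sub_apply, ← map_sub, ← map_sub]
      congr 2
      simp only [Matrix.mul_add, Matrix.mul_sub, Matrix.mul_assoc]
      abel
    rw [h3]
    refine (norm_sub_le _ _).trans ?_
    have h4 : d (Xᵀ * E) 1 * ‖v‖ ≤ τ * ‖v‖ := by gcongr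
    have h5 : (Matrix.toEuclideanLin (Xᵀ * E)).singularValues 0 = d (Xᵀ * E) 1 := rfl
    rw [h5] at h2
    linarith
  refine ⟨LinearMap.singularValues_le_add_of_norm_sub_le _ _ (by positivity) hdiff _,
    LinearMap.singularValues_le_add_of_norm_sub_le _ _ (by positivity) (fun v => ?_) _⟩
  rw [norm_sub_rev]
  exact hdiff v

theorem calibratedRank_eq_rank {m n p : ℕ} {X : Matrix (Fin m) (Fin p) ℝ}
    {A : Matrix (Fin p) (Fin n) ℝ} {E : Matrix (Fin m) (Fin n) ℝ} {τ : ℝ}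
    {B : Matrix (Fin p) (Fin n) ℝ} (hB : IsNNPEstimate X (X * A + E) τ B)
    (hE : d (Xᵀ * E) 1 ≤ τ) (hsignal : 1 ≤ A.rank → 4 * τ < d (Xᵀ * X * A) A.rank) :
    calibratedRank X τ B = A.rank := by
  refine le_antisymm (Finset.sup_le fun k hk => ?_) ?_
  · by_contra! hlt
    have h1 : d (Xᵀ * X * A) k = 0 :=
      d_eq_zero_of_rank_lt _ ((Matrix.rank_mul_le_right _ _).trans_lt hlt)
    have h2 := (abs_d_sub_d_le hB hE k).2
    have h3 := (Finset.mem_filter.1 hk).2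
    linarith
  · rcases Nat.eq_zero_or_pos A.rank with h0 | h0
    · rw [h0]; exact Nat.zero_le _
    · have h1 := hsignal h0
      have h2 := (abs_d_sub_d_le hB hE A.rank).1
      refine Finset.le_sup (f := id) (Finset.mem_filter.2 ⟨Finset.mem_Icc.2 ⟨h0, ?_⟩, ?_⟩)
      · exact le_min A.rank_le_height A.rank_le_width
      · change 2 * τ < d (Xᵀ * X * B) A.rank
        linarith

theorem measureReal_calibratedRank_ne_le {Ω : Type*} [MeasurableSpace Ω] (P : Measure Ω)
    [IsFiniteMeasure P] {m n p : ℕ} (X : Matrix (Fin m) (Fin p) ℝ) (A : Matrix (Fin p) (Fin n) ℝ)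
    (E : Ω → Matrix (Fin m) (Fin n) ℝ) (τ : ℝ) (B : Ω → Matrix (Fin p) (Fin n) ℝ)
    (hB : ∀ ω, IsNNPEstimate X (X * A + E ω) τ (B ω))
    (hsignal : 1 ≤ A.rank → 4 * τ < d (Xᵀ * X * A) A.rank) :
    P.real {ω | calibratedRank X τ (B ω) ≠ A.rank} ≤ P.real {ω | τ < d (Xᵀ * E ω) 1} :=
  measureReal_mono fun ω hω => lt_of_not_ge fun hle =>
    hω (calibratedRank_eq_rank (hB ω) hle hsignal)

end ReducedRank

namespace ProbabilityTheory

open Module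
open scoped RealInnerProductSpace

variable {V : Type*} [NormedAddCommGroup V] [InnerProductSpace ℝ V]

/-- The density of the standard Gaussian measure with respect to the Lebesgue measure. -/
noncomputable def stdGaussianPDFReal (x : V) : ℝ :=
  ((2 * Real.pi) ^ (finrank ℝ V / 2 : ℝ))⁻¹ * Real.exp (-(1 / 2) * ‖x‖ ^ 2)

theorem stdGaussianPDFReal_nonneg (x : V) : 0 ≤ stdGaussianPDFReal x := by
  unfold stdGaussianPDFReal; positivity

theorem continuous_stdGaussianPDFReal : Continuous (stdGaussianPDFReal (V := V)) := by
  unfold stdGaussianPDFReal; fun_prop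

variable [FiniteDimensional ℝ V] [MeasurableSpace V] [BorelSpace V]

theorem integrable_stdGaussianPDFReal : Integrable (stdGaussianPDFReal (V := V)) := by
  have h := (GaussianFourier.integrable_cexp_neg_mul_sq_norm_add (V := V) (b := 1 / 2)
    (by norm_num) 0 0).re
  refine (h.const_mul ((2 * Real.pi) ^ (finrank ℝ V / 2 : ℝ))⁻¹).congr
    (Filter.Eventually.of_forall fun x => ?_)
  have hx : (-(1 / 2) * (‖x‖ : ℂ) ^ 2 + 0 * (⟪(0 : V), x⟫ : ℝ))
      = ((-(1 / 2) * ‖x‖ ^ 2 : ℝ) : ℂ) := by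
    push_cast
    ring
  simp only [stdGaussianPDFReal]
  rw [hx, ← Complex.ofReal_exp]
  rfl

theorem stdGaussian_eq_withDensity :
    stdGaussian V = volume.withDensity fun x => ENNReal.ofReal (stdGaussianPDFReal x) := by
  have : IsFiniteMeasure
      (volume.withDensity fun x : V => ENNReal.ofReal (stdGaussianPDFReal x)) :=
    isFiniteMeasure_withDensity_ofReal integrable_stdGaussianPDFReal.2
  refine Measure.ext_of_charFun ?_
  ext t
  rw [charFun_stdGaussian, charFun_apply, integral_withDensity_eq_integral_toReal_smul
    (by have := continuous_stdGaussianPDFReal (V := V); fun_prop) (by simp)]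
  have h := GaussianFourier.integral_cexp_neg_mul_sq_norm_add (V := V) (b := 1 / 2)
    (by norm_num) Complex.I t
  have hpi : ((Real.pi : ℂ) / (1 / 2)) ^ (finrank ℝ V / 2 : ℂ)
      = ((2 * Real.pi) ^ (finrank ℝ V / 2 : ℝ) : ℝ) := by
    rw [Complex.ofReal_cpow (by positivity)]
    push_cast
    congr 1
    ring
  rw [hpi] at h
  have hpos : ((2 * Real.pi) ^ (finrank ℝ V / 2 : ℝ) : ℝ) ≠ 0 := by positivity
  calc Complex.exp (-‖t‖ ^ 2 / 2)
      = (((2 * Real.pi) ^ (finrank ℝ V / 2 : ℝ) : ℝ) : ℂ)⁻¹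
        * ∫ v : V, Complex.exp (-(1 / 2) * ‖v‖ ^ 2 + Complex.I * ⟪t, v⟫) := by
        rw [h, ← mul_assoc, inv_mul_cancel₀ (by exact_mod_cast hpos), one_mul, Complex.I_sq]
        congr 1
        ring
    _ = _ := by
        rw [← integral_const_mul]
        congr 1
        ext v
        rw [ENNReal.toReal_ofReal (stdGaussianPDFReal_nonneg v), stdGaussianPDFReal,
          Complex.exp_add, real_inner_comm]
        simp only [Complex.real_smul]
        push_cast
        ring_nf

theorem integral_stdGaussian (f : V → ℝ) :
    ∫ x, f x ∂(stdGaussian V) = ∫ x, stdGaussianPDFReal x * f x := by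
  rw [stdGaussian_eq_withDensity, integral_withDensity_eq_integral_toReal_smul
    (by have := continuous_stdGaussianPDFReal (V := V); fun_prop) (by simp)]
  simp only [ENNReal.toReal_ofReal (stdGaussianPDFReal_nonneg _), smul_eq_mul]

theorem integrable_stdGaussian_iff (f : V → ℝ) :
    Integrable f (stdGaussian V) ↔ Integrable fun x => stdGaussianPDFReal x * f x := by
  rw [stdGaussian_eq_withDensity, integrable_withDensity_iff_integrable_smul'
    (by have := continuous_stdGaussianPDFReal (V := V); fun_prop) (by simp)]
  simp only [ENNReal.toReal_ofReal (stdGaussianPDFReal_nonneg _), smul_eq_mul]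

/-- **Stein's lemma**, Gaussian integration by parts. -/
theorem integral_inner_mul_stdGaussian {f f' : V → ℝ} {v : V}
    (hf : ∀ x, HasLineDerivAt ℝ f (f' x) x v) (hfi : Integrable f (stdGaussian V))
    (hf'i : Integrable f' (stdGaussian V))
    (hvf : Integrable (fun x => ⟪v, x⟫ * f x) (stdGaussian V)) :
    ∫ x, ⟪v, x⟫ * f x ∂(stdGaussian V) = ∫ x, f' x ∂(stdGaussian V) := by
  rw [integrable_stdGaussian_iff] at hfi hf'i hvf
  rw [integral_stdGaussian, integral_stdGaussian]
  have hpdf : ∀ x : V, HasLineDerivAt ℝ stdGaussianPDFReal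
      (-⟪v, x⟫ * stdGaussianPDFReal x) x v := by
    intro x
    have h1 : HasDerivAt (fun t : ℝ => ‖x + t • v‖ ^ 2) (2 * ⟪x + (0 : ℝ) • v, v⟫) 0 := by
      have := ((hasDerivAt_id (0 : ℝ)).smul_const v).const_add x
      simpa using this.norm_sq
    have h2 := ((h1.const_mul (-(1 / 2) : ℝ)).exp).const_mul
      ((2 * Real.pi) ^ (finrank ℝ V / 2 : ℝ))⁻¹
    refine HasDerivAt.congr_deriv h2 ?_
    simp only [zero_smul, add_zero, stdGaussianPDFReal, real_inner_comm v]
    ring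
  have h := integral_bilinear_hasLineDerivAt_right_eq_neg_left_of_integrable (μ := volume)
    (B := ContinuousLinearMap.mul ℝ ℝ) (f := stdGaussianPDFReal (V := V)) (g := f) (g' := f')
    (f' := fun x => -⟪v, x⟫ * stdGaussianPDFReal x) (v := v) ?_ ?_ ?_ (fun x _ => hpdf x)
    (fun x _ => hf x)
  · simp only [ContinuousLinearMap.mul_apply'] at h
    rw [h, ← integral_neg]
    congr 1
    ext x
    ring
  · refine hvf.neg.congr (Filter.Eventually.of_forall fun x => ?_)
    simp only [ContinuousLinearMap.mul_apply', Pi.neg_apply]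
    ring
  · exact hf'i
  · exact hfi

theorem integrable_exp_mul_norm_stdGaussian (c : ℝ) :
    Integrable (fun x : V => Real.exp (c * ‖x‖)) (stdGaussian V) := by
  obtain ⟨C, hC, hint⟩ := IsGaussian.exists_integrable_exp_sq (stdGaussian V)
  refine (hint.const_mul (Real.exp (c ^ 2 / (4 * C)))).mono' (by fun_prop)
    (Filter.Eventually.of_forall fun x => ?_)
  rw [Real.norm_of_nonneg (Real.exp_nonneg _), ← Real.exp_add]
  refine Real.exp_le_exp.2 ?_
  have : c ^ 2 / (4 * C) + C * ‖x‖ ^ 2 - c * ‖x‖ = (2 * C * ‖x‖ - c) ^ 2 / (4 * C) := by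
    field_simp
    ring
  have h2 : 0 ≤ (2 * C * ‖x‖ - c) ^ 2 / (4 * C) := by positivity
  linarith

theorem integrable_norm_mul_exp_mul_norm_stdGaussian (c : ℝ) :
    Integrable (fun x : V => ‖x‖ * Real.exp (c * ‖x‖)) (stdGaussian V) := by
  refine (integrable_exp_mul_norm_stdGaussian (V := V) (c + 1)).mono' (by fun_prop)
    (Filter.Eventually.of_forall fun x => ?_)
  rw [Real.norm_of_nonneg (by positivity), add_mul, one_mul, add_comm, Real.exp_add]
  gcongr
  linarith [Real.add_one_le_exp ‖x‖]

end ProbabilityTheory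

namespace ProbabilityTheory

open scoped RealInnerProductSpace

section LogSumExp

variable {ι : Type*} [Fintype ι]

/-- The logarithm of `∑ i, exp (β z i)`. -/
noncomputable def logSumExp (β : ℝ) (z : ι → ℝ) : ℝ := Real.log (∑ i, Real.exp (β * z i))

/-- The softmax weight of the coordinate `i`. -/
noncomputable def softmaxWeight (β : ℝ) (z : ι → ℝ) (i : ι) : ℝ :=
  Real.exp (β * z i - logSumExp β z)

theorem softmaxWeight_nonneg (β : ℝ) (z : ι → ℝ) (i : ι) : 0 ≤ softmaxWeight β z i :=
  Real.exp_nonneg _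

/-- The smooth approximation `(∑ i, exp (β z i)) ^ (l / β)` of `exp (l max z)`. -/
noncomputable def softmaxExp (l β : ℝ) (z : ι → ℝ) : ℝ := Real.exp (l / β * logSumExp β z)

theorem softmaxExp_pos (l β : ℝ) (z : ι → ℝ) : 0 < softmaxExp l β z := Real.exp_pos _

variable [Nonempty ι]

theorem sum_exp_pos (β : ℝ) (z : ι → ℝ) : 0 < ∑ i, Real.exp (β * z i) :=
  Finset.sum_pos (fun _ _ => Real.exp_pos _) Finset.univ_nonempty

theorem exp_logSumExp (β : ℝ) (z : ι → ℝ) :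
    Real.exp (logSumExp β z) = ∑ i, Real.exp (β * z i) :=
  Real.exp_log (sum_exp_pos β z)

theorem sum_softmaxWeight (β : ℝ) (z : ι → ℝ) : ∑ i, softmaxWeight β z i = 1 := by
  simp only [softmaxWeight, Real.exp_sub, exp_logSumExp]
  rw [← Finset.sum_div, div_self (sum_exp_pos β z).ne']

theorem softmaxWeight_le_one (β : ℝ) (z : ι → ℝ) (i : ι) : softmaxWeight β z i ≤ 1 := by
  rw [← sum_softmaxWeight β z]
  exact Finset.single_le_sum (fun j _ => softmaxWeight_nonneg β z j) (Finset.mem_univ i)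

theorem le_logSumExp (β : ℝ) (z : ι → ℝ) (i : ι) : β * z i ≤ logSumExp β z := by
  have := softmaxWeight_le_one β z i
  rw [softmaxWeight, Real.exp_le_one_iff] at this
  linarith

theorem logSumExp_le {β : ℝ} (hβ : 0 ≤ β) {z : ι → ℝ} {M : ℝ} (hM : ∀ i, z i ≤ M) :
    logSumExp β z ≤ Real.log (Fintype.card ι) + β * M := by
  rw [logSumExp, ← Real.log_exp (β * M), ← Real.log_mul (by simp) (Real.exp_ne_zero _)]
  refine Real.log_le_log (sum_exp_pos β z) ?_
  calc ∑ i, Real.exp (β * z i) ≤ ∑ _i : ι, Real.exp (β * M) := by gcongr; exact hM _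
    _ = _ := by simp

theorem hasDerivAt_logSumExp {β t : ℝ} {z : ℝ → ι → ℝ} {z' : ι → ℝ}
    (hz : ∀ i, HasDerivAt (fun s => z s i) (z' i) t) :
    HasDerivAt (fun s => logSumExp β (z s)) (∑ i, softmaxWeight β (z t) i * (β * z' i)) t := by
  have h1 : HasDerivAt (fun s => ∑ i, Real.exp (β * z s i))
      (∑ i, Real.exp (β * z t i) * (β * z' i)) t :=
    HasDerivAt.fun_sum fun i _ => ((hz i).const_mul β).exp
  refine (h1.log (sum_exp_pos β (z t)).ne').congr_deriv ?_
  rw [Finset.sum_div]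
  refine Finset.sum_congr rfl fun i _ => ?_
  rw [softmaxWeight, Real.exp_sub, exp_logSumExp]
  ring

theorem hasDerivAt_softmaxWeight {β t : ℝ} {z : ℝ → ι → ℝ} {z' : ι → ℝ}
    (hz : ∀ i, HasDerivAt (fun s => z s i) (z' i) t) (i : ι) :
    HasDerivAt (fun s => softmaxWeight β (z s) i)
      (softmaxWeight β (z t) i * (β * z' i - ∑ j, softmaxWeight β (z t) j * (β * z' j))) t :=
  (((hz i).const_mul β).sub (hasDerivAt_logSumExp hz)).exp

theorem continuous_logSumExp (β : ℝ) : Continuous (logSumExp β : (ι → ℝ) → ℝ) :=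
  Continuous.log (by fun_prop) fun z => (sum_exp_pos β z).ne'

theorem continuous_softmaxExp (l β : ℝ) : Continuous (softmaxExp l β : (ι → ℝ) → ℝ) := by
  have := continuous_logSumExp (ι := ι) β
  unfold softmaxExp
  fun_prop

theorem continuous_softmaxWeight (β : ℝ) (i : ι) :
    Continuous fun z : ι → ℝ => softmaxWeight β z i := by
  have := continuous_logSumExp (ι := ι) β
  unfold softmaxWeight
  fun_prop

theorem exp_mul_le_softmaxExp {l β : ℝ} (hl : 0 ≤ l) (hβ : 0 < β) (z : ι → ℝ) (i : ι) :
    Real.exp (l * z i) ≤ softmaxExp l β z := by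
  refine Real.exp_le_exp.2 ?_
  calc l * z i = l / β * (β * z i) := by field_simp
    _ ≤ _ := mul_le_mul_of_nonneg_left (le_logSumExp β z i) (by positivity)

theorem softmaxExp_le {l β : ℝ} (hl : 0 ≤ l) (hβ : 0 < β) {z : ι → ℝ} {M : ℝ}
    (hM : ∀ i, z i ≤ M) :
    softmaxExp l β z ≤ Real.exp (l / β * Real.log (Fintype.card ι)) * Real.exp (l * M) := by
  rw [← Real.exp_add]
  refine Real.exp_le_exp.2 ?_
  calc l / β * logSumExp β z ≤ l / β * (Real.log (Fintype.card ι) + β * M) :=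
        mul_le_mul_of_nonneg_left (logSumExp_le hβ.le hM) (by positivity)
    _ = _ := by field_simp

theorem hasDerivAt_softmaxExp {l β t : ℝ} (hβ : β ≠ 0) {z : ℝ → ι → ℝ} {z' : ι → ℝ}
    (hz : ∀ i, HasDerivAt (fun s => z s i) (z' i) t) :
    HasDerivAt (fun s => softmaxExp l β (z s))
      (l * ∑ i, z' i * (softmaxWeight β (z t) i * softmaxExp l β (z t))) t := by
  refine (((hasDerivAt_logSumExp hz).const_mul (l / β)).exp).congr_deriv ?_
  rw [← softmaxExp, Finset.mul_sum, Finset.mul_sum, Finset.mul_sum]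
  refine Finset.sum_congr rfl fun i _ => ?_
  field_simp

theorem hasDerivAt_softmaxWeight_mul_softmaxExp {l β t : ℝ} (hβ : β ≠ 0) {z : ℝ → ι → ℝ}
    {z' : ι → ℝ} (hz : ∀ i, HasDerivAt (fun s => z s i) (z' i) t) (i : ι) :
    HasDerivAt (fun s => softmaxWeight β (z s) i * softmaxExp l β (z s))
      (softmaxWeight β (z t) i * softmaxExp l β (z t)
        * (β * z' i + (l - β) * ∑ j, softmaxWeight β (z t) j * z' j)) t := by
  refine ((hasDerivAt_softmaxWeight hz i).mul (hasDerivAt_softmaxExp hβ hz)).congr_deriv ?_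
  have h1 : ∑ j, softmaxWeight β (z t) j * (β * z' j)
      = β * ∑ j, softmaxWeight β (z t) j * z' j := by
    rw [Finset.mul_sum]
    exact Finset.sum_congr rfl fun j _ => by ring
  have h2 : ∑ j, z' j * (softmaxWeight β (z t) j * softmaxExp l β (z t))
      = softmaxExp l β (z t) * ∑ j, softmaxWeight β (z t) j * z' j := by
    rw [Finset.mul_sum]
    exact Finset.sum_congr rfl fun j _ => by ring
  rw [h1, h2]
  ring

end LogSumExp

section Comparison

variable {ι V : Type*} [Fintype ι] [Nonempty ι] [NormedAddCommGroup V] [InnerProductSpace ℝ V]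

theorem softmaxExp_inner_le {l β : ℝ} (hl : 0 ≤ l) (hβ : 0 < β) {c : ι → V} {K : ℝ}
    (hK : ∀ i, ‖c i‖ ≤ K) (x : V) :
    softmaxExp l β (fun i => ⟪c i, x⟫)
      ≤ Real.exp (l / β * Real.log (Fintype.card ι)) * Real.exp (l * K * ‖x‖) := by
  rw [mul_assoc]
  refine softmaxExp_le hl hβ fun i => (real_inner_le_norm _ _).trans ?_
  gcongr
  exact hK i

theorem continuous_softmaxWeight_inner (β : ℝ) (c : ι → V) (i : ι) :
    Continuous fun x : V => softmaxWeight β (fun j => ⟪c j, x⟫) i :=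
  (continuous_softmaxWeight β i).comp (by fun_prop : Continuous fun x : V => fun j => ⟪c j, x⟫)

theorem continuous_softmaxExp_inner (l β : ℝ) (c : ι → V) :
    Continuous fun x : V => softmaxExp l β (fun j => ⟪c j, x⟫) :=
  (continuous_softmaxExp l β).comp (by fun_prop)

theorem norm_softmaxWeight_mul_softmaxExp_le (l β : ℝ) (z : ι → ℝ) (i : ι) :
    ‖softmaxWeight β z i * softmaxExp l β z‖ ≤ softmaxExp l β z := by
  rw [Real.norm_of_nonneg (mul_nonneg (softmaxWeight_nonneg _ _ _) (softmaxExp_pos _ _ _).le)]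
  exact mul_le_of_le_one_left (softmaxExp_pos _ _ _).le (softmaxWeight_le_one _ _ _)

variable [FiniteDimensional ℝ V] [MeasurableSpace V] [BorelSpace V]

theorem integrable_softmaxExp_inner {l β : ℝ} (hl : 0 ≤ l) (hβ : 0 < β) (c : ι → V) :
    Integrable (fun x => softmaxExp l β (fun i => ⟪c i, x⟫)) (stdGaussian V) := by
  refine ((integrable_exp_mul_norm_stdGaussian (l * ∑ i, ‖c i‖)).const_mul
    (Real.exp (l / β * Real.log (Fintype.card ι)))).mono'
    ((continuous_softmaxExp l β).comp (by fun_prop)).aestronglyMeasurable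
    (Filter.Eventually.of_forall fun x => ?_)
  rw [Real.norm_of_nonneg (softmaxExp_pos _ _ _).le]
  exact softmaxExp_inner_le hl hβ
    (fun i => Finset.single_le_sum (fun j _ => norm_nonneg (c j)) (Finset.mem_univ i)) x

theorem integrable_softmaxWeight_mul_softmaxExp {l β : ℝ} (hl : 0 ≤ l) (hβ : 0 < β) (c : ι → V)
    (i : ι) : Integrable (fun x => softmaxWeight β (fun j => ⟪c j, x⟫) i
      * softmaxExp l β (fun j => ⟪c j, x⟫)) (stdGaussian V) :=
  (integrable_softmaxExp_inner hl hβ c).mono'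
    ((continuous_softmaxWeight_inner β c i).mul
      (continuous_softmaxExp_inner l β c)).aestronglyMeasurable
    (Filter.Eventually.of_forall fun _ => norm_softmaxWeight_mul_softmaxExp_le _ _ _ _)

theorem integrable_lineDeriv_softmaxWeight_mul_softmaxExp {l β : ℝ} (hl : 0 ≤ l) (hβ : 0 < β)
    (c : ι → V) (v : V) (i : ι) :
    Integrable (fun x => softmaxWeight β (fun j => ⟪c j, x⟫) i * softmaxExp l β (fun j => ⟪c j, x⟫)
      * (β * ⟪c i, v⟫ + (l - β) * ∑ j, softmaxWeight β (fun j => ⟪c j, x⟫) j * ⟪c j, v⟫))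
      (stdGaussian V) := by
  have hcw := continuous_softmaxWeight_inner β c
  refine (integrable_softmaxWeight_mul_softmaxExp hl hβ c i).mul_bdd
    (c := |β * ⟪c i, v⟫| + |l - β| * ∑ j, |⟪c j, v⟫|)
    (Continuous.aestronglyMeasurable (by fun_prop)) (Filter.Eventually.of_forall fun x => ?_)
  refine (abs_add_le _ _).trans ?_
  rw [abs_mul (l - β)]
  gcongr
  refine (Finset.abs_sum_le_sum_abs _ _).trans (Finset.sum_le_sum fun j _ => ?_)
  rw [abs_mul, abs_of_nonneg (softmaxWeight_nonneg _ _ _)]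
  exact mul_le_of_le_one_left (abs_nonneg _) (softmaxWeight_le_one _ _ _)

/-- Gaussian integration by parts for the derivative of the smoothed maximum in the direction
`v` along the coordinate `i`. -/
theorem integral_inner_mul_softmaxWeight {l β : ℝ} (hl : 0 ≤ l) (hβ : 0 < β) (c : ι → V) (v : V)
    (i : ι) :
    ∫ x, ⟪v, x⟫ * (softmaxWeight β (fun j => ⟪c j, x⟫) i
        * softmaxExp l β (fun j => ⟪c j, x⟫)) ∂(stdGaussian V)
      = ∫ x, softmaxWeight β (fun j => ⟪c j, x⟫) i * softmaxExp l β (fun j => ⟪c j, x⟫)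
        * (β * ⟪c i, v⟫ + (l - β) * ∑ j, softmaxWeight β (fun j => ⟪c j, x⟫) j * ⟪c j, v⟫)
          ∂(stdGaussian V) := by
  have hcw := continuous_softmaxWeight_inner β c
  have hce := continuous_softmaxExp_inner l β c
  refine integral_inner_mul_stdGaussian (fun x => ?_)
    (integrable_softmaxWeight_mul_softmaxExp hl hβ c i)
    (integrable_lineDeriv_softmaxWeight_mul_softmaxExp hl hβ c v i) ?_
  · have hz : ∀ j, HasDerivAt (fun s : ℝ => ⟪c j, x + s • v⟫) ⟪c j, v⟫ 0 := by
      intro j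
      have h1 : (fun s : ℝ => ⟪c j, x + s • v⟫) = fun s => ⟪c j, x⟫ + s * ⟪c j, v⟫ := by
        ext s
        rw [inner_add_right, inner_smul_right]
      rw [h1]
      simpa using ((hasDerivAt_id (0 : ℝ)).mul_const ⟪c j, v⟫).const_add ⟪c j, x⟫
    have h := hasDerivAt_softmaxWeight_mul_softmaxExp (l := l) hβ.ne'
      (z := fun s j => ⟪c j, x + s • v⟫) hz i
    simp only [zero_smul, add_zero] at h
    exact h
  · refine ((integrable_norm_mul_exp_mul_norm_stdGaussian (V := V) (l * ∑ i, ‖c i‖)).const_mul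
      (‖v‖ * Real.exp (l / β * Real.log (Fintype.card ι)))).mono'
      (Continuous.aestronglyMeasurable (by fun_prop)) (Filter.Eventually.of_forall fun x => ?_)
    rw [norm_mul]
    calc ‖⟪v, x⟫‖ * _ ≤ (‖v‖ * ‖x‖) * (Real.exp (l / β * Real.log (Fintype.card ι))
          * Real.exp (l * (∑ i, ‖c i‖) * ‖x‖)) := by
          gcongr
          · exact norm_inner_le_norm _ _
          · exact (norm_softmaxWeight_mul_softmaxExp_le _ _ _ _).trans (softmaxExp_inner_le hl hβ
              (fun i => Finset.single_le_sum (fun j _ => norm_nonneg (c j)) (Finset.mem_univ i)) x)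
      _ = _ := by ring

theorem hasDerivAt_integral_softmaxExp {l β : ℝ} (hl : 0 ≤ l) (hβ : 0 < β) {c c' : ℝ → ι → V}
    {K : ℝ} (hK : ∀ t i, ‖c t i‖ ≤ K) (hK' : ∀ t i, ‖c' t i‖ ≤ K)
    (hc : ∀ t i, HasDerivAt (fun s => c s i) (c' t i) t) (t : ℝ) :
    HasDerivAt (fun s => ∫ x, softmaxExp l β (fun i => ⟪c s i, x⟫) ∂(stdGaussian V))
      (l * ∑ i, ∫ x, softmaxWeight β (fun j => ⟪c t j, x⟫) i
        * softmaxExp l β (fun j => ⟪c t j, x⟫) * (β * ⟪c t i, c' t i⟫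
          + (l - β) * ∑ j, softmaxWeight β (fun j => ⟪c t j, x⟫) j * ⟪c t j, c' t i⟫)
            ∂(stdGaussian V)) t := by
  have hcw := fun t => continuous_softmaxWeight_inner β (c t)
  have hce := fun t => continuous_softmaxExp_inner l β (c t)
  have hterm : ∀ s i x, ‖⟪c' s i, x⟫ * (softmaxWeight β (fun j => ⟪c s j, x⟫) i
      * softmaxExp l β (fun j => ⟪c s j, x⟫))‖ ≤ K * Real.exp (l / β * Real.log (Fintype.card ι))
        * (‖x‖ * Real.exp (l * K * ‖x‖)) := by
    intro s i x
    rw [norm_mul]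
    calc ‖⟪c' s i, x⟫‖ * _ ≤ (K * ‖x‖) * (Real.exp (l / β * Real.log (Fintype.card ι))
          * Real.exp (l * K * ‖x‖)) := by
          gcongr
          · exact mul_nonneg ((norm_nonneg _).trans (hK s i)) (norm_nonneg x)
          · exact (norm_inner_le_norm _ _).trans (by gcongr; exact hK' s i)
          · exact (norm_softmaxWeight_mul_softmaxExp_le _ _ _ _).trans
              (softmaxExp_inner_le hl hβ (hK s) x)
      _ = _ := by ring
  have hbound := (integrable_norm_mul_exp_mul_norm_stdGaussian (V := V) (l * K)).const_mul
    (K * Real.exp (l / β * Real.log (Fintype.card ι)))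
  have h := (hasDerivAt_integral_of_dominated_loc_of_deriv_le (μ := stdGaussian V)
    (F := fun s x => softmaxExp l β (fun i => ⟪c s i, x⟫))
    (F' := fun s x => l * ∑ i, ⟪c' s i, x⟫ * (softmaxWeight β (fun j => ⟪c s j, x⟫) i
      * softmaxExp l β (fun j => ⟪c s j, x⟫)))
    (bound := fun x => l * ∑ _i : ι, K * Real.exp (l / β * Real.log (Fintype.card ι))
        * (‖x‖ * Real.exp (l * K * ‖x‖))) (x₀ := t) Filter.univ_mem
    (Filter.Eventually.of_forall fun s => (hce s).aestronglyMeasurable)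
    (integrable_softmaxExp_inner hl hβ (c t))
    (Continuous.aestronglyMeasurable (by fun_prop))
    (Filter.Eventually.of_forall fun x s _ => ?_)
    ((integrable_finsetSum _ fun _ _ => hbound).const_mul l)
    (Filter.Eventually.of_forall fun x s _ => ?_)).2
  · refine h.congr_deriv ?_
    rw [integral_const_mul, integral_finsetSum]
    · simp only [integral_inner_mul_softmaxWeight hl hβ]
    · exact fun i _ => hbound.mono' (Continuous.aestronglyMeasurable (by fun_prop))
        (Filter.Eventually.of_forall (hterm t i))
  · rw [norm_mul, Real.norm_of_nonneg hl]
    gcongr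
    exact (norm_sum_le _ _).trans (Finset.sum_le_sum fun i _ => hterm s i x)
  · refine hasDerivAt_softmaxExp (z := fun s i => ⟪c s i, x⟫) (z' := fun i => ⟪c' s i, x⟫) hβ.ne'
      fun i => ?_
    simpa using (hc s i).inner ℝ (hasDerivAt_const s x)

/-- **Gaussian comparison inequality** of Slepian type for exponential moments of the smoothed
maximum of the processes `⟪a i, x⟫` and `⟪b i, x⟫`. -/
theorem exp_mul_integral_softmaxExp_le {l β : ℝ} (hl : 0 ≤ l) (hlβ : l ≤ β) (hβ : 0 < β)
    {a b : ι → V} (hab : ∀ i j, ⟪a i, b j⟫ = 0) (hdiag : ∀ i, ⟪b i, b i⟫ = ⟪a i, a i⟫ + 1)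
    (hcov : ∀ i j, ⟪b i, b j⟫ ≤ ⟪a i, a j⟫ + 1) :
    Real.exp (l ^ 2 / 2) * ∫ x, softmaxExp l β (fun i => ⟪a i, x⟫) ∂(stdGaussian V)
      ≤ ∫ x, softmaxExp l β (fun i => ⟪b i, x⟫) ∂(stdGaussian V) := by
  set c : ℝ → ι → V := fun t i => Real.sin t • a i + Real.cos t • b i with hcdef
  set c' : ℝ → ι → V := fun t i => Real.cos t • a i - Real.sin t • b i with hc'def
  have hle : ∀ i, ‖a i‖ + ‖b i‖ ≤ ∑ i, (‖a i‖ + ‖b i‖) := fun i =>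
    Finset.single_le_sum (f := fun i => ‖a i‖ + ‖b i‖) (fun j _ => by positivity)
      (Finset.mem_univ i)
  have hbd : ∀ (s : ℝ) (v : V), |s| ≤ 1 → ‖s • v‖ ≤ ‖v‖ := by
    intro s v hs
    rw [norm_smul]
    exact mul_le_of_le_one_left (norm_nonneg v) hs
  have hK : ∀ t i, ‖c t i‖ ≤ ∑ i, (‖a i‖ + ‖b i‖) := fun t i =>
    (norm_add_le _ _).trans ((add_le_add (hbd _ _ (Real.abs_sin_le_one t))
      (hbd _ _ (Real.abs_cos_le_one t))).trans (hle i))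
  have hK' : ∀ t i, ‖c' t i‖ ≤ ∑ i, (‖a i‖ + ‖b i‖) := fun t i =>
    (norm_sub_le _ _).trans ((add_le_add (hbd _ _ (Real.abs_cos_le_one t))
      (hbd _ _ (Real.abs_sin_le_one t))).trans (hle i))
  have hc : ∀ t i, HasDerivAt (fun s => c s i) (c' t i) t := by
    intro t i
    refine (((Real.hasDerivAt_sin t).smul_const (a i)).add
      ((Real.hasDerivAt_cos t).smul_const (b i))).congr_deriv ?_
    rw [neg_smul, ← sub_eq_add_neg]
  have hinner : ∀ t i j, ⟪c t j, c' t i⟫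
      = Real.sin t * Real.cos t * (⟪a i, a j⟫ - ⟪b i, b j⟫) := by
    intro t i j
    simp only [hcdef, hc'def, inner_add_left, inner_sub_right, inner_smul_left, inner_smul_right,
      hab, real_inner_comm (a i) (b j), conj_trivial, real_inner_comm (a i) (a j),
      real_inner_comm (b i) (b j)]
    ring
  set Φ : ℝ → ℝ := fun t => ∫ x, softmaxExp l β (fun i => ⟪c t i, x⟫) ∂(stdGaussian V) with hΦ
  have hderiv := hasDerivAt_integral_softmaxExp hl hβ hK hK' hc
  have hle : ∀ t ∈ Set.Icc 0 (Real.pi / 2), l * ∑ i, ∫ x, softmaxWeight β (fun j => ⟪c t j, x⟫) i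
        * softmaxExp l β (fun j => ⟪c t j, x⟫) * (β * ⟪c t i, c' t i⟫
          + (l - β) * ∑ j, softmaxWeight β (fun j => ⟪c t j, x⟫) j * ⟪c t j, c' t i⟫)
            ∂(stdGaussian V) ≤ -(l ^ 2 * (Real.sin t * Real.cos t)) * Φ t := by
    intro t ht
    have hsc : 0 ≤ Real.sin t * Real.cos t := mul_nonneg
      (Real.sin_nonneg_of_nonneg_of_le_pi ht.1 (by linarith [ht.2, Real.pi_pos]))
      (Real.cos_nonneg_of_neg_pi_div_two_le_of_le (by linarith [ht.1, Real.pi_pos]) ht.2)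
    have hwe := integrable_softmaxWeight_mul_softmaxExp hl hβ (c t)
    have hsum : Φ t = ∑ i, ∫ x, softmaxWeight β (fun j => ⟪c t j, x⟫) i
        * softmaxExp l β (fun j => ⟪c t j, x⟫) ∂(stdGaussian V) := by
      rw [← integral_finsetSum _ fun i _ => hwe i]
      simp only [← Finset.sum_mul, sum_softmaxWeight, one_mul, hΦ]
    have hstep : ∀ i, ∫ x, softmaxWeight β (fun j => ⟪c t j, x⟫) i
        * softmaxExp l β (fun j => ⟪c t j, x⟫) * (β * ⟪c t i, c' t i⟫
          + (l - β) * ∑ j, softmaxWeight β (fun j => ⟪c t j, x⟫) j * ⟪c t j, c' t i⟫)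
            ∂(stdGaussian V)
        ≤ -(l * (Real.sin t * Real.cos t)) * ∫ x, softmaxWeight β (fun j => ⟪c t j, x⟫) i
        * softmaxExp l β (fun j => ⟪c t j, x⟫) ∂(stdGaussian V) := by
      intro i
      rw [← integral_const_mul]
      refine integral_mono (integrable_lineDeriv_softmaxWeight_mul_softmaxExp hl hβ (c t) _ i)
        ((hwe i).const_mul _) fun x => ?_
      have hpos := mul_nonneg (softmaxWeight_nonneg β (fun j => ⟪c t j, x⟫) i)
        (softmaxExp_pos l β (fun j => ⟪c t j, x⟫)).le
      have hwsum : -(Real.sin t * Real.cos t)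
          ≤ ∑ j, softmaxWeight β (fun j => ⟪c t j, x⟫) j * ⟪c t j, c' t i⟫ := by
        calc -(Real.sin t * Real.cos t)
            = ∑ j, softmaxWeight β (fun j => ⟪c t j, x⟫) j * -(Real.sin t * Real.cos t) := by
              rw [← Finset.sum_mul, sum_softmaxWeight, one_mul]
          _ ≤ _ := by
              refine Finset.sum_le_sum fun j _ =>
                mul_le_mul_of_nonneg_left ?_ (softmaxWeight_nonneg _ _ _)
              rw [hinner]
              nlinarith [hcov i j]
      have hd : ⟪c t i, c' t i⟫ = -(Real.sin t * Real.cos t) := by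
        rw [hinner, hdiag]
        ring
      simp only [hd]
      calc _ ≤ softmaxWeight β (fun j => ⟪c t j, x⟫) i * softmaxExp l β (fun j => ⟪c t j, x⟫)
            * (-(l * (Real.sin t * Real.cos t))) := by
            refine mul_le_mul_of_nonneg_left ?_ hpos
            nlinarith [mul_le_mul_of_nonpos_left hwsum (sub_nonpos.2 hlβ)]
        _ = _ := mul_comm _ _
    rw [hsum, Finset.mul_sum, Finset.mul_sum]
    refine Finset.sum_le_sum fun i _ => ?_
    calc _ ≤ l * (-(l * (Real.sin t * Real.cos t)) * ∫ x, softmaxWeight β (fun j => ⟪c t j, x⟫) i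
        * softmaxExp l β (fun j => ⟪c t j, x⟫) ∂(stdGaussian V)) :=
          mul_le_mul_of_nonneg_left (hstep i) hl
      _ = _ := by ring
  have hanti : AntitoneOn (fun t => Real.exp (l ^ 2 / 2 * Real.sin t ^ 2) * Φ t)
      (Set.Icc 0 (Real.pi / 2)) := by
    have hd : ∀ t, HasDerivAt (fun t => Real.exp (l ^ 2 / 2 * Real.sin t ^ 2) * Φ t) _ t := fun t =>
      ((((Real.hasDerivAt_sin t).pow 2).const_mul (l ^ 2 / 2)).exp).mul (hderiv t)
    refine antitoneOn_of_deriv_nonpos (convex_Icc _ _)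
      (fun t _ => (hd t).continuousAt.continuousWithinAt)
      (fun t _ => (hd t).differentiableAt.differentiableWithinAt) fun t ht => ?_
    rw [(hd t).deriv]
    have h1 := mul_le_mul_of_nonneg_left (hle t (interior_subset ht))
      (Real.exp_nonneg (l ^ 2 / 2 * Real.sin t ^ 2))
    simp only [Nat.cast_ofNat, Nat.add_one_sub_one, pow_one, Pi.pow_apply]
    refine (add_le_add_right h1 _).trans (le_of_eq ?_)
    ring
  have h := hanti (Set.left_mem_Icc.2 (by positivity)) (Set.right_mem_Icc.2 (by positivity))
    (by positivity)
  simpa [hΦ, hcdef] using h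

end Comparison

end ProbabilityTheory

namespace ProbabilityTheory

open scoped RealInnerProductSpace

section ChiSquare

theorem integrable_exp_mul_sq_gaussianReal {s : ℝ} (hs : s < 1 / 2) :
    Integrable (fun x : ℝ => Real.exp (s * x ^ 2)) (gaussianReal 0 1) := by
  rw [gaussianReal_of_var_ne_zero 0 one_ne_zero,
    integrable_withDensity_iff_integrable_smul' (by fun_prop)
      (Filter.Eventually.of_forall fun _ => gaussianPDF_lt_top)]
  simp only [toReal_gaussianPDF]
  have h := (integrable_exp_neg_mul_sq (b := 1 / 2 - s) (by linarith)).const_mul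
    (√(2 * Real.pi * (1 : NNReal)))⁻¹
  refine h.congr (Filter.Eventually.of_forall fun x => ?_)
  simp only [gaussianPDFReal, smul_eq_mul, mul_assoc, ← Real.exp_add]
  simp only [NNReal.coe_one, sub_zero, mul_one]
  congr 2
  ring

theorem integral_exp_mul_sq_gaussianReal {s : ℝ} (hs : s < 1 / 2) :
    ∫ x, Real.exp (s * x ^ 2) ∂(gaussianReal 0 1) = (√(1 - 2 * s))⁻¹ := by
  rw [integral_gaussianReal_eq_integral_smul one_ne_zero]
  have h : ∀ x : ℝ, gaussianPDFReal 0 1 x • Real.exp (s * x ^ 2)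
      = (√(2 * Real.pi))⁻¹ * Real.exp (-(1 / 2 - s) * x ^ 2) := by
    intro x
    simp only [gaussianPDFReal, smul_eq_mul, mul_assoc, ← Real.exp_add]
    simp only [NNReal.coe_one, sub_zero, mul_one]
    congr 2
    ring
  simp only [h]
  rw [integral_const_mul, integral_gaussian]
  have hpos : 0 < 1 - 2 * s := by linarith
  have h2 : Real.pi / (1 / 2 - s) = 2 * Real.pi / (1 - 2 * s) := by
    have : 0 < 1 / 2 - s := by linarith
    field_simp
  rw [h2, Real.sqrt_div (by positivity)]
  have : 0 < √(2 * Real.pi) := by positivity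
  field_simp

theorem integral_exp_mul_sq_gaussianReal_le {l r : ℝ} (hl : 0 ≤ l) (hr : 0 < r) :
    ∫ x, Real.exp (l / (2 * (r + l)) * x ^ 2) ∂(gaussianReal 0 1) ≤ Real.exp (l / (2 * r)) := by
  have hrl : 0 < r + l := by linarith
  have hs : l / (2 * (r + l)) < 1 / 2 := by
    rw [div_lt_div_iff₀ (by positivity) two_pos]
    linarith
  rw [integral_exp_mul_sq_gaussianReal hs, ← inv_inv (Real.exp _), ← Real.exp_neg]
  refine inv_anti₀ (Real.exp_pos _) (Real.le_sqrt_of_sq_le ?_)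
  rw [← Real.exp_nat_mul]
  have h1 : 1 - 2 * (l / (2 * (r + l))) = (1 + l / r)⁻¹ := by
    field_simp
    ring
  have h2 : ((2 : ℕ) : ℝ) * -(l / (2 * r)) = -(l / r) := by
    push_cast
    field_simp
  rw [h1, h2, Real.exp_neg]
  refine inv_anti₀ (by positivity) ?_
  rw [add_comm]
  exact Real.add_one_le_exp _

variable {ι : Type*} [Fintype ι]

theorem integral_stdGaussian_euclideanSpace (f : EuclideanSpace ℝ ι → ℝ) (hf : Continuous f) :
    ∫ x, f x ∂(stdGaussian (EuclideanSpace ℝ ι))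
      = ∫ x : ι → ℝ, f (WithLp.toLp 2 x) ∂(Measure.pi fun _ => gaussianReal 0 1) := by
  rw [← map_pi_eq_stdGaussian, integral_map (by fun_prop) hf.aestronglyMeasurable]

theorem integral_exp_sum_mul_sq_stdGaussian (s : ι → ℝ) :
    ∫ x, Real.exp (∑ i, s i * x i ^ 2) ∂(stdGaussian (EuclideanSpace ℝ ι))
      = ∏ i, ∫ x, Real.exp (s i * x ^ 2) ∂(gaussianReal 0 1) := by
  rw [integral_stdGaussian_euclideanSpace _ (by fun_prop)]
  simp only [Real.exp_sum]
  exact integral_fintype_prod_eq_prod fun i x => Real.exp (s i * x ^ 2)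

theorem integrable_exp_sum_mul_sq_stdGaussian {s : ι → ℝ} (hs : ∀ i, s i < 1 / 2) :
    Integrable (fun x : EuclideanSpace ℝ ι => Real.exp (∑ i, s i * x i ^ 2))
      (stdGaussian (EuclideanSpace ℝ ι)) := by
  rw [← map_pi_eq_stdGaussian, integrable_map_measure
    (Continuous.aestronglyMeasurable (by fun_prop)) (by fun_prop)]
  have := Integrable.fintype_prod (μ := fun _ : ι => gaussianReal 0 1)
    (f := fun i x => Real.exp (s i * x ^ 2)) fun i => integrable_exp_mul_sq_gaussianReal (hs i)
  refine this.congr (Filter.Eventually.of_forall fun x => ?_)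
  simp [Real.exp_sum]

end ChiSquare

section Chevet

variable {κ ν ρ I : Type*} [Fintype κ] [Fintype ν] [Fintype ρ]

theorem mul_norm_le_quadratic {l c : ℝ} (hl : 0 ≤ l) (hc : 0 < c) (x : EuclideanSpace ℝ ρ) :
    l * ‖x‖ ≤ l * c / 2 + ∑ k, l / (2 * c) * x k ^ 2 := by
  rw [← Finset.mul_sum, ← EuclideanSpace.real_norm_sq_eq]
  have h : l * c / 2 + l / (2 * c) * ‖x‖ ^ 2 - l * ‖x‖ = l / (2 * c) * (c - ‖x‖) ^ 2 := by
    field_simp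
    ring
  have : 0 ≤ l / (2 * c) * (c - ‖x‖) ^ 2 := by positivity
  linarith

variable [Fintype I] [Nonempty I]

theorem integral_softmaxExp_sum_le [Nonempty ρ] [Nonempty ν] {l β : ℝ} (hl : 0 ≤ l) (hβ : 0 < β)
    {w : I → EuclideanSpace ℝ ρ} {v : I → EuclideanSpace ℝ ν} (hw : ∀ i, ‖w i‖ = 1)
    (hv : ∀ i, ‖v i‖ = 1) :
    ∫ x, softmaxExp l β (fun i => ⟪(WithLp.toLp 2 (Sum.elim 0 (Sum.elim (w i) (v i))) :
        EuclideanSpace ℝ ((κ × ν) ⊕ (ρ ⊕ ν))), x⟫) ∂(stdGaussian _)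
      ≤ Real.exp (l / β * Real.log (Fintype.card I))
        * Real.exp (l * (√(Fintype.card ρ) + √(Fintype.card ν)) + l ^ 2) := by
  set rρ := √(Fintype.card ρ : ℝ) with hrρ
  set rν := √(Fintype.card ν : ℝ) with hrν
  have hρ0 : 0 < rρ := Real.sqrt_pos.2 (by exact_mod_cast Fintype.card_pos)
  have hν0 : 0 < rν := Real.sqrt_pos.2 (by exact_mod_cast Fintype.card_pos)
  set s : (κ × ν) ⊕ (ρ ⊕ ν) → ℝ := Sum.elim (fun _ => 0)
    (Sum.elim (fun _ => l / (2 * (rρ + l))) (fun _ => l / (2 * (rν + l)))) with hs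
  have hlt : ∀ r : ℝ, 0 < r → l / (2 * (r + l)) < 1 / 2 := by
    intro r hr
    rw [div_lt_div_iff₀ (by positivity) two_pos]
    linarith
  have hs2 : ∀ i, s i < 1 / 2 := by
    rintro (i | i | i)
    · simp [hs]
    · exact hlt rρ hρ0
    · exact hlt rν hν0
  have hpt : ∀ x : EuclideanSpace ℝ ((κ × ν) ⊕ (ρ ⊕ ν)),
      softmaxExp l β (fun i => ⟪(WithLp.toLp 2 (Sum.elim 0 (Sum.elim (w i) (v i))) :
        EuclideanSpace ℝ ((κ × ν) ⊕ (ρ ⊕ ν))), x⟫)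
      ≤ Real.exp (l / β * Real.log (Fintype.card I))
        * Real.exp (l * (rρ + l) / 2 + l * (rν + l) / 2) * Real.exp (∑ i, s i * x i ^ 2) := by
    intro x
    set xρ : EuclideanSpace ℝ ρ := WithLp.toLp 2 fun k => x (Sum.inr (Sum.inl k)) with hxρ
    set xν : EuclideanSpace ℝ ν := WithLp.toLp 2 fun k => x (Sum.inr (Sum.inr k)) with hxν
    have hM : ∀ i, ⟪(WithLp.toLp 2 (Sum.elim 0 (Sum.elim (w i) (v i))) :
        EuclideanSpace ℝ ((κ × ν) ⊕ (ρ ⊕ ν))), x⟫ ≤ ‖xρ‖ + ‖xν‖ := by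
      intro i
      have h1 := real_inner_le_norm (w i) xρ
      have h2 := real_inner_le_norm (v i) xν
      rw [hw, one_mul] at h1
      rw [hv, one_mul] at h2
      refine le_trans (le_of_eq ?_) (add_le_add h1 h2)
      simp [PiLp.inner_apply, hxρ, hxν]
    refine (softmaxExp_le hl hβ hM).trans ?_
    rw [mul_assoc (Real.exp _) (Real.exp _), ← Real.exp_add (_ + _)]
    refine mul_le_mul_of_nonneg_left (Real.exp_le_exp.2 ?_) (Real.exp_nonneg _)
    have h1 := mul_norm_le_quadratic hl (by positivity : 0 < rρ + l) xρ
    have h2 := mul_norm_le_quadratic hl (by positivity : 0 < rν + l) xν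
    simp only [Fintype.sum_sum_type, hs, Sum.elim_inl, Sum.elim_inr, zero_mul,
      Finset.sum_const_zero, zero_add]
    simp only [hxρ, hxν] at h1 h2
    linarith
  calc _ ≤ ∫ x, Real.exp (l / β * Real.log (Fintype.card I))
        * Real.exp (l * (rρ + l) / 2 + l * (rν + l) / 2) * Real.exp (∑ i, s i * x i ^ 2)
          ∂(stdGaussian (EuclideanSpace ℝ ((κ × ν) ⊕ (ρ ⊕ ν)))) :=
        integral_mono (integrable_softmaxExp_inner hl hβ _)
          ((integrable_exp_sum_mul_sq_stdGaussian hs2).const_mul _) hpt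
    _ ≤ Real.exp (l / β * Real.log (Fintype.card I))
        * Real.exp (l * (rρ + l) / 2 + l * (rν + l) / 2)
        * Real.exp (l * rρ / 2 + l * rν / 2) := by
        rw [integral_const_mul, integral_exp_sum_mul_sq_stdGaussian]
        gcongr
        simp only [Fintype.prod_sum_type, hs, Sum.elim_inl, Sum.elim_inr, zero_mul, Real.exp_zero,
          integral_const, probReal_univ, smul_eq_mul, mul_one, Finset.prod_const_one, one_mul,
          Finset.prod_const, Finset.card_univ, Real.exp_add]
        have hpow : ∀ (N : ℕ) (r : ℝ), 0 < r → r = √(N : ℝ) →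
            (∫ x, Real.exp (l / (2 * (r + l)) * x ^ 2) ∂(gaussianReal 0 1)) ^ N
              ≤ Real.exp (l * r / 2) := by
          intro N r hr hrN
          calc _ ≤ Real.exp (l / (2 * r)) ^ N := by
                refine pow_le_pow_left₀ (integral_nonneg fun _ => Real.exp_nonneg _) ?_ N
                exact integral_exp_mul_sq_gaussianReal_le hl hr
            _ = _ := by
                rw [← Real.exp_nat_mul]
                congr 1
                have hN : (N : ℝ) = r ^ 2 := by rw [hrN, Real.sq_sqrt (Nat.cast_nonneg N)]
                rw [hN]
                field_simp
        exact mul_le_mul (hpow _ _ hρ0 hrρ) (hpow _ _ hν0 hrν)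
          (pow_nonneg (integral_nonneg fun _ => Real.exp_nonneg _) _) (Real.exp_nonneg _)
    _ = _ := by
        rw [mul_assoc, ← Real.exp_add]
        congr 2
        ring

theorem map_stdGaussian_restrict_inl (α α' : Type*) [Fintype α] [Fintype α'] :
    (stdGaussian (EuclideanSpace ℝ (α ⊕ α'))).map (fun x (k : α) => x (Sum.inl k))
      = Measure.pi fun _ => gaussianReal 0 1 := by
  rw [← map_pi_eq_stdGaussian, Measure.map_map (by fun_prop) (by fun_prop)]
  exact (measurePreserving_fst.comp
    (measurePreserving_sumPiEquivProdPi fun _ : α ⊕ α' => gaussianReal 0 1)).map_eq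

/-- Chevet's inequality in exponential tail form, for finitely many pairs of unit vectors. The
family `w'` realizes the Gram matrix of `w` in a space of smaller dimension. -/
theorem measureReal_exists_lt_bilinear_le [Nonempty ρ] [Nonempty ν] {l s : ℝ} (hl : 0 < l)
    {w : I → EuclideanSpace ℝ κ} {w' : I → EuclideanSpace ℝ ρ} {v : I → EuclideanSpace ℝ ν}
    (hww : ∀ i j, ⟪w' i, w' j⟫ = ⟪w i, w j⟫) (hw : ∀ i, ‖w' i‖ = 1) (hv : ∀ i, ‖v i‖ = 1) :
    (Measure.pi fun _ : κ × ν => gaussianReal 0 1).real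
        {g | ∃ i, s < ∑ k : κ × ν, w i k.1 * v i k.2 * g k}
      ≤ Real.exp (l * (√(Fintype.card ρ) + √(Fintype.card ν)) + l ^ 2 / 2 - l * s) := by
  set a : I → EuclideanSpace ℝ ((κ × ν) ⊕ (ρ ⊕ ν)) := fun i =>
    WithLp.toLp 2 (Sum.elim (fun k => w i k.1 * v i k.2) 0) with ha
  set b : I → EuclideanSpace ℝ ((κ × ν) ⊕ (ρ ⊕ ν)) := fun i =>
    WithLp.toLp 2 (Sum.elim 0 (Sum.elim (w' i) (v i))) with hb
  have haa : ∀ i j, ⟪a i, a j⟫ = ⟪w' i, w' j⟫ * ⟪v i, v j⟫ := by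
    intro i j
    rw [hww]
    simp only [PiLp.inner_apply, ha, Fintype.sum_sum_type, Sum.elim_inl, Sum.elim_inr,
      Pi.zero_apply, inner_zero_left, Finset.sum_const_zero, add_zero, Fintype.sum_prod_type,
      Finset.sum_mul_sum]
    refine Finset.sum_congr rfl fun k _ => Finset.sum_congr rfl fun k' _ => ?_
    simp only [RCLike.inner_apply, conj_trivial]
    ring
  have hbb : ∀ i j, ⟪b i, b j⟫ = ⟪w' i, w' j⟫ + ⟪v i, v j⟫ := by
    intro i j
    simp [PiLp.inner_apply, hb]
  have hab : ∀ i j, ⟪a i, b j⟫ = 0 := by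
    intro i j
    simp [PiLp.inner_apply, ha, hb]
  have hevent : MeasurableSet {g : κ × ν → ℝ | ∃ i, s < ∑ k : κ × ν, w i k.1 * v i k.2 * g k} := by
    rw [Set.ofPred_exists]
    exact MeasurableSet.iUnion fun i => measurableSet_lt (by fun_prop) (by fun_prop)
  have hlaw : (Measure.pi fun _ : κ × ν => gaussianReal 0 1).real
        {g | ∃ i, s < ∑ k : κ × ν, w i k.1 * v i k.2 * g k}
      = (stdGaussian (EuclideanSpace ℝ ((κ × ν) ⊕ (ρ ⊕ ν)))).real {x | ∃ i, s < ⟪a i, x⟫} := by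
    rw [← map_stdGaussian_restrict_inl (κ × ν) (ρ ⊕ ν),
      map_measureReal_apply (by fun_prop) hevent]
    congr 1
    ext x
    simp [PiLp.inner_apply, ha, mul_comm]
  have hbound : ∀ N : ℕ, 0 < N → (stdGaussian (EuclideanSpace ℝ ((κ × ν) ⊕ (ρ ⊕ ν)))).real
      {x | ∃ i, s < ⟪a i, x⟫} ≤ Real.exp (1 / N * Real.log (Fintype.card I))
        * Real.exp (l * (√(Fintype.card ρ) + √(Fintype.card ν)) + l ^ 2 / 2 - l * s) := by
    intro N hN
    have hN1 : (1 : ℝ) ≤ N := by exact_mod_cast hN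
    have hβ : 0 < l * N := by positivity
    have h1 := exp_mul_integral_softmaxExp_le hl.le (le_mul_of_one_le_right hl.le hN1) hβ hab
      (fun i => by rw [hbb, haa, real_inner_self_eq_norm_sq, real_inner_self_eq_norm_sq, hw, hv]
                   norm_num)
      (fun i j => by
        have hx := real_inner_le_norm (w' i) (w' j)
        have hy := real_inner_le_norm (v i) (v j)
        rw [hw, hw, one_mul] at hx
        rw [hv, hv, one_mul] at hy
        rw [hbb, haa]
        nlinarith [mul_nonneg (sub_nonneg.2 hx) (sub_nonneg.2 hy)])
    have h2 := integral_softmaxExp_sum_le (κ := κ) hl.le hβ hw hv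
    have h3 := mul_meas_ge_le_integral_of_nonneg
      (Filter.Eventually.of_forall fun x => (softmaxExp_pos l (l * N) fun i => ⟪a i, x⟫).le)
      (integrable_softmaxExp_inner hl.le hβ a) (Real.exp (l * s))
    have h4 : (stdGaussian (EuclideanSpace ℝ ((κ × ν) ⊕ (ρ ⊕ ν)))).real {x | ∃ i, s < ⟪a i, x⟫}
        ≤ (stdGaussian (EuclideanSpace ℝ ((κ × ν) ⊕ (ρ ⊕ ν)))).real
          {x | Real.exp (l * s) ≤ softmaxExp l (l * N) fun i => ⟪a i, x⟫} := by
      refine measureReal_mono ?_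
      rintro x ⟨i, hi⟩
      exact (Real.exp_le_exp.2 (by gcongr)).trans
        (exp_mul_le_softmaxExp hl.le hβ (fun i => ⟪a i, x⟫) i)
    have h5 : l / (l * N) = 1 / (N : ℝ) := by field_simp
    rw [h5] at h2
    have h6 := (mul_le_mul_of_nonneg_left ((mul_le_mul_of_nonneg_left h4
      (Real.exp_nonneg (l * s))).trans h3) (Real.exp_nonneg (l ^ 2 / 2))).trans (h1.trans h2)
    rw [← mul_assoc, ← Real.exp_add, mul_comm, ← le_div_iff₀ (Real.exp_pos _)] at h6
    refine h6.trans (le_of_eq ?_)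
    rw [mul_div_assoc, ← Real.exp_sub]
    congr 2
    ring
  rw [hlaw]
  have hlim : Filter.Tendsto (fun N : ℕ => Real.exp (1 / N * Real.log (Fintype.card I))
        * Real.exp (l * (√(Fintype.card ρ) + √(Fintype.card ν)) + l ^ 2 / 2 - l * s))
      Filter.atTop (nhds (Real.exp (0 * Real.log (Fintype.card I))
        * Real.exp (l * (√(Fintype.card ρ) + √(Fintype.card ν)) + l ^ 2 / 2 - l * s))) :=
    ((Real.continuous_exp.tendsto _).comp
      (tendsto_one_div_atTop_nhds_zero_nat.mul_const _)).mul_const _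
  rw [zero_mul, Real.exp_zero, one_mul] at hlim
  exact ge_of_tendsto hlim (Filter.eventually_of_mem (Filter.Ioi_mem_atTop 0) fun N hN =>
    hbound N hN)

end Chevet

end ProbabilityTheory

namespace ProbabilityTheory

open scoped RealInnerProductSpace

/-- Chevet's inequality in exponential tail form, for the bilinear form of a Gaussian matrix on the
product of the unit spheres of a subspace `W` and of the whole space. -/
theorem measureReal_exists_unit_lt_bilinear_le {κ ν : Type*} [Fintype κ] [Fintype ν]
    (W : Submodule ℝ (EuclideanSpace ℝ κ)) {l s : ℝ} (hl : 0 < l) :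
    (Measure.pi fun _ : κ × ν => gaussianReal 0 1).real
        {g | ∃ w ∈ W, ∃ v : EuclideanSpace ℝ ν, ‖w‖ = 1 ∧ ‖v‖ = 1
          ∧ s < ∑ k : κ × ν, w k.1 * v k.2 * g k}
      ≤ Real.exp (l * (√(Module.finrank ℝ W) + √(Fintype.card ν)) + l ^ 2 / 2 - l * s) := by
  let T := {p : W × EuclideanSpace ℝ ν // ‖p.1‖ = 1 ∧ ‖p.2‖ = 1}
  rcases isEmpty_or_nonempty T with hT | hT
  · have hempty : {g : κ × ν → ℝ | ∃ w ∈ W, ∃ v : EuclideanSpace ℝ ν, ‖w‖ = 1 ∧ ‖v‖ = 1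
          ∧ s < ∑ k : κ × ν, w k.1 * v k.2 * g k} = ∅ := by
      refine Set.eq_empty_of_forall_notMem ?_
      rintro g ⟨w, hwW, v, hw, hv, -⟩
      exact hT.false ⟨(⟨w, hwW⟩, v), hw, hv⟩
    rw [hempty, measureReal_empty]
    exact Real.exp_nonneg _
  · obtain ⟨⟨⟨w₀, v₀⟩, hw₀, hv₀⟩⟩ := id hT
    have hν : Nonempty ν := by
      by_contra hν
      rw [not_nonempty_iff] at hν
      rw [Subsingleton.elim v₀ 0, norm_zero] at hv₀
      exact zero_ne_one hv₀
    have hρ : Nonempty (Fin (Module.finrank ℝ W)) := by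
      have : Nontrivial W := ⟨w₀, 0, by rintro rfl; simp at hw₀⟩
      exact ⟨⟨0, Module.finrank_pos⟩⟩
    let D := TopologicalSpace.denseSeq T
    let A : ℕ → Set (κ × ν → ℝ) := fun N => {g | ∃ i : Fin (N + 1),
      s < ∑ k : κ × ν, ((D i).1.1 : EuclideanSpace ℝ κ) k.1 * (D i).1.2 k.2 * g k}
    have hA : Monotone A := by
      rintro M N hMN g ⟨i, hi⟩
      exact ⟨Fin.castLE (by omega) i, hi⟩
    have hsub : {g : κ × ν → ℝ | ∃ w ∈ W, ∃ v : EuclideanSpace ℝ ν, ‖w‖ = 1 ∧ ‖v‖ = 1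
          ∧ s < ∑ k : κ × ν, w k.1 * v k.2 * g k} ⊆ ⋃ N, A N := by
      rintro g ⟨w, hwW, v, hw, hv, hs⟩
      have hopen : IsOpen {p : T | s < ∑ k : κ × ν,
          (p.1.1 : EuclideanSpace ℝ κ) k.1 * p.1.2 k.2 * g k} :=
        isOpen_lt continuous_const (by fun_prop)
      obtain ⟨N, hp⟩ := (TopologicalSpace.denseRange_denseSeq T).exists_mem_open hopen
        ⟨⟨(⟨w, hwW⟩, v), hw, hv⟩, hs⟩
      exact Set.mem_iUnion.2 ⟨N, ⟨N, Nat.lt_succ_self N⟩, hp⟩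
    have hbound : ∀ N, (Measure.pi fun _ : κ × ν => gaussianReal 0 1) (A N)
        ≤ ENNReal.ofReal (Real.exp (l * (√(Module.finrank ℝ W) + √(Fintype.card ν))
          + l ^ 2 / 2 - l * s)) := by
      intro N
      have h := measureReal_exists_lt_bilinear_le (I := Fin (N + 1))
        (ρ := Fin (Module.finrank ℝ W)) (s := s) hl
        (w := fun i => ((D i).1.1 : EuclideanSpace ℝ κ))
        (w' := fun i => (stdOrthonormalBasis ℝ W).repr (D i).1.1)
        (v := fun i => (D i).1.2) (fun i j => by
          rw [LinearIsometryEquiv.inner_map_map, Submodule.coe_inner])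
        (fun i => by rw [LinearIsometryEquiv.norm_map]; exact (D i).2.1) (fun i => (D i).2.2)
      rw [Fintype.card_fin] at h
      rw [← ofReal_measureReal]
      exact ENNReal.ofReal_le_ofReal h
    refine ENNReal.toReal_le_of_le_ofReal (Real.exp_nonneg _) ?_
    refine (measure_mono hsub).trans ?_
    rw [hA.measure_iUnion]
    exact iSup_le hbound

end ProbabilityTheory

namespace ReducedRank

open scoped RealInnerProductSpace

theorem IsIIDGaussian.map_eq {Ω : Type*} [MeasurableSpace Ω] {P : Measure Ω}
    [IsProbabilityMeasure P] {m n : ℕ} {E : Ω → Matrix (Fin m) (Fin n) ℝ} {σ : ℝ}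
    (h : IsIIDGaussian P E σ) :
    P.map (fun ω (k : Fin m × Fin n) => E ω k.1 k.2)
      = (Measure.pi fun _ => gaussianReal 0 1).map fun g k => σ * g k := by
  rw [(iIndepFun_iff_map_fun_eq_pi_map fun k : Fin m × Fin n => (h.2 k.1 k.2).aemeasurable).1 h.1,
    Measure.pi_map_pi fun _ => by fun_prop]
  congr 1
  ext1 k
  rw [(h.2 k.1 k.2).map_eq, gaussianReal_map_const_mul, mul_zero, mul_one]
  congr 1
  exact Real.toNNReal_of_nonneg (sq_nonneg σ)

theorem exists_unit_lt_bilinear_of_lt_d {m n p : ℕ} (X : Matrix (Fin m) (Fin p) ℝ)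
    (E : Matrix (Fin m) (Fin n) ℝ) {c : ℝ} (hc : 0 ≤ c) (h : c * d X 1 < d (Xᵀ * E) 1) :
    ∃ w ∈ LinearMap.range (Matrix.toEuclideanLin X), ∃ v : EuclideanSpace ℝ (Fin n),
      ‖w‖ = 1 ∧ ‖v‖ = 1 ∧ c < ∑ k : Fin m × Fin n, w k.1 * v k.2 * E k.1 k.2 := by
  have hpos : 0 < d (Xᵀ * E) 1 := (mul_nonneg hc (d_nonneg X 1)).trans_lt h
  obtain ⟨v, hv, hvd⟩ :=
    (Matrix.toEuclideanLin (Xᵀ * E)).exists_norm_map_eq_singularValues_zero hpos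
  change ‖Matrix.toEuclideanLin (Xᵀ * E) v‖ = d (Xᵀ * E) 1 at hvd
  set y := Matrix.toEuclideanLin (Xᵀ * E) v with hy
  set w := Matrix.toEuclideanLin X y with hw
  have hinner : ∑ k : Fin m × Fin n, w k.1 * v k.2 * E k.1 k.2 = ‖y‖ ^ 2 := by
    have h1 : ∑ k : Fin m × Fin n, w k.1 * v k.2 * E k.1 k.2 = w ⬝ᵥ E *ᵥ v := by
      rw [← sum_mul_vecMulVec, Fintype.sum_prod_type]
      simp only [Matrix.vecMulVec_apply, mul_comm]
    have h2 : (w : Fin m → ℝ) = X *ᵥ y := rfl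
    rw [h1, h2, EuclideanSpace.real_norm_sq_eq, ← Matrix.vecMul_transpose,
      ← Matrix.dotProduct_mulVec, Matrix.mulVec_mulVec]
    simp [hy, Matrix.toEuclideanLin, Matrix.toLpLin_apply, dotProduct, sq]
  have hle : ‖w‖ ≤ d X 1 * ‖y‖ := (Matrix.toEuclideanLin X).norm_map_le_singularValues_zero y
  have hypos : 0 < ‖y‖ := hvd ▸ hpos
  have hwpos : 0 < ‖w‖ := by
    rw [norm_pos_iff]
    intro h0
    rw [h0] at hinner
    simp only [PiLp.zero_apply, zero_mul, Finset.sum_const_zero] at hinner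
    exact (pow_pos hypos 2).ne hinner
  refine ⟨‖w‖⁻¹ • w, Submodule.smul_mem _ _ (LinearMap.mem_range_self _ _), v, ?_, hv, ?_⟩
  · rw [norm_smul, norm_inv, norm_norm, inv_mul_cancel₀ hwpos.ne']
  · simp only [PiLp.smul_apply, smul_eq_mul, mul_assoc]
    rw [← Finset.mul_sum, ← div_eq_inv_mul, lt_div_iff₀ hwpos]
    simp only [← mul_assoc]
    rw [hinner]
    calc c * ‖w‖ ≤ c * (d X 1 * ‖y‖) := by gcongr
      _ = (c * d X 1) * ‖y‖ := by ring
      _ < ‖y‖ * ‖y‖ := by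
          rw [hvd] at hypos ⊢
          gcongr
      _ = ‖y‖ ^ 2 := by ring

theorem measureReal_lt_d_transpose_mul_le {Ω : Type*} [MeasurableSpace Ω] (P : Measure Ω)
    [IsProbabilityMeasure P] {m n p : ℕ} (X : Matrix (Fin m) (Fin p) ℝ)
    {E : Ω → Matrix (Fin m) (Fin n) ℝ} {σ θ : ℝ} (hσ : 0 ≤ σ) (hθ : 0 < θ)
    (hE : IsIIDGaussian P E σ) :
    P.real {ω | (1 + θ) * σ * d X 1 * (√(n : ℝ) + √(X.rank : ℝ)) < d (Xᵀ * E ω) 1}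
      ≤ Real.exp (-(θ ^ 2 * ((n : ℝ) + (X.rank : ℝ)) / 2)) := by
  set K := √(X.rank : ℝ) + √(n : ℝ) with hK
  have hK0 : 0 ≤ K := by positivity
  have hKsq : (n : ℝ) + X.rank ≤ K ^ 2 := by
    have h1 := Real.sq_sqrt (Nat.cast_nonneg (α := ℝ) n)
    have h2 := Real.sq_sqrt (Nat.cast_nonneg (α := ℝ) X.rank)
    have h3 : 0 ≤ √(X.rank : ℝ) * √(n : ℝ) := by positivity
    rw [hK]
    nlinarith
  rcases hK0.eq_or_lt with h0 | hKpos
  · have hzero : (n : ℝ) + X.rank = 0 := by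
      rw [← h0, zero_pow two_ne_zero] at hKsq
      exact le_antisymm hKsq (by positivity)
    rw [hzero, mul_zero, zero_div, neg_zero, Real.exp_zero]
    exact measureReal_le_one
  let W := LinearMap.range (Matrix.toEuclideanLin X)
  let S : ℝ → Set (Fin m × Fin n → ℝ) := fun c => {g | ∃ w ∈ W,
    ∃ v : EuclideanSpace ℝ (Fin n), ‖w‖ = 1 ∧ ‖v‖ = 1
      ∧ c < ∑ k : Fin m × Fin n, w k.1 * v k.2 * g k}
  have hS : ∀ c, MeasurableSet (S c) := by
    intro c
    refine IsOpen.measurableSet ?_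
    simp only [S, Set.ofPred_exists, Set.ofPred_and]
    refine isOpen_iUnion fun w => isOpen_const.inter <| isOpen_iUnion fun v =>
      isOpen_const.inter <| isOpen_const.inter <| isOpen_lt continuous_const (by fun_prop)
  have hc : 0 ≤ σ * ((1 + θ) * K) := by positivity
  calc P.real {ω | (1 + θ) * σ * d X 1 * (√(n : ℝ) + √(X.rank : ℝ)) < d (Xᵀ * E ω) 1}
      ≤ P.real ((fun ω (k : Fin m × Fin n) => E ω k.1 k.2) ⁻¹' S (σ * ((1 + θ) * K))) := by
        refine measureReal_mono fun ω hω => exists_unit_lt_bilinear_of_lt_d X (E ω) hc ?_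
        refine lt_of_eq_of_lt ?_ hω
        rw [hK]
        ring
    _ = (Measure.pi fun _ : Fin m × Fin n => gaussianReal 0 1).real
          ((fun g k => σ * g k) ⁻¹' S (σ * ((1 + θ) * K))) := by
        rw [← map_measureReal_apply_of_aemeasurable
          (aemeasurable_pi_lambda _ fun k => (hE.2 k.1 k.2).aemeasurable) (hS _), hE.map_eq,
          map_measureReal_apply (by fun_prop) (hS _)]
    _ ≤ (Measure.pi fun _ : Fin m × Fin n => gaussianReal 0 1).real (S ((1 + θ) * K)) := by
        refine measureReal_mono ?_
        rintro g ⟨w, hwW, v, hw, hv, hlt⟩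
        refine ⟨w, hwW, v, hw, hv, lt_of_mul_lt_mul_left ?_ hσ⟩
        rw [Finset.mul_sum]
        refine hlt.trans_eq (Finset.sum_congr rfl fun k _ => ?_)
        ring
    _ ≤ Real.exp (θ * K * (√(Module.finrank ℝ W) + √(Fintype.card (Fin n)))
          + (θ * K) ^ 2 / 2 - θ * K * ((1 + θ) * K)) :=
        measureReal_exists_unit_lt_bilinear_le W (by positivity)
    _ ≤ _ := by
        rw [finrank_range_toEuclideanLin, Fintype.card_fin, ← hK]
        refine Real.exp_le_exp.2 ?_
        nlinarith [mul_le_mul_of_nonneg_left hKsq (sq_nonneg θ)]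

end ReducedRank

theorem theorem13 {Ω : Type*} [MeasurableSpace Ω] (P : Measure Ω) [IsProbabilityMeasure P]
    {m n p : ℕ} (X : Matrix (Fin m) (Fin p) ℝ) (A : Matrix (Fin p) (Fin n) ℝ)
    (E : Ω → Matrix (Fin m) (Fin n) ℝ) (hE : ∀ i j, AEMeasurable (fun ω => E ω i j) P)
    (τ : ℝ) (Atilde : Ω → Matrix (Fin p) (Fin n) ℝ)
    (hAtilde : ∀ ω, ReducedRank.IsNNPEstimate X (X * A + E ω) τ (Atilde ω))
    (hsignal : 1 ≤ A.rank → 4 * τ < ReducedRank.d (Xᵀ * X * A) A.rank) :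
    P.real {ω | ReducedRank.calibratedRank X τ (Atilde ω) ≠ A.rank}
        ≤ P.real {ω | τ < ReducedRank.d (Xᵀ * E ω) 1} ∧
    ∀ σ θ : ℝ, 0 ≤ σ → 0 < θ → ReducedRank.IsIIDGaussian P E σ →
      τ = (1 + θ) * σ * ReducedRank.d X 1 * (√(n : ℝ) + √(X.rank : ℝ)) →
      P.real {ω | τ < ReducedRank.d (Xᵀ * E ω) 1}
          ≤ Real.exp (-(θ ^ 2 * ((n : ℝ) + (X.rank : ℝ)) / 2)) ∧
      P.real {ω | ReducedRank.calibratedRank X τ (Atilde ω) ≠ A.rank}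
          ≤ Real.exp (-(θ ^ 2 * ((n : ℝ) + (X.rank : ℝ)) / 2)) := by
  have hle := ReducedRank.measureReal_calibratedRank_ne_le P X A E τ Atilde hAtilde hsignal
  refine ⟨hle, fun σ θ hσ hθ hG hτ => ?_⟩
  have htail := ReducedRank.measureReal_lt_d_transpose_mul_le P X hσ hθ hG
  rw [← hτ] at htail
  exact ⟨htail, hle.trans htail⟩
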